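/- Let $k\ge 2$ be an integer. A finite automaton with output has finitely many states, an initial state, an output attached to each state, and for every state exactly one outgoing edge labelled by each of the digits $0,1,\dots,k-1$. It generates the sequence $(a(n))_{n\ge 0}$ if, for every $n\ge 0$, reading the base-$k$ expansion of $n$ (most significant digit first), started in the initial state, leads to a state with output $a(n)$. A sequence $a$ is called a synchronizing $k$-automatic sequence if it is generated by such an automaton for which there is a word $w\in\{0,1,\dots,k-1\}^*$ leading from every state to one and the same state. (This holds if and only if the minimal automaton generating $a$ has such a word.) A sequence $b=(b(n))_{n\ge 0}$ with values in a finite alphabet is called deterministic if its subword complexity $$N_H(b)=\bigl|\{(b(n),b(n+1),\dots,b(n+H-1)) : n\ge 0\}\bigr|$$ is subexponential, that is, if $\lim_{H\to\infty}\frac{\log N_H(b)}{H}=0$. **Theorem.** Let $k\ge 2$ and let $a$ be a synchronizing $k$-automatic sequence. Then for every non-integer real number $c>1$ the sequence $(a(\lfloor n^c\rfloor))_{n\ge 0}$ is deterministic. -/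

import Mathlib

open Filter Topology

/-- A deterministic automaton with output, with set of states `σ`, input alphabet
`{0, …, k - 1}` and output alphabet `A`. Every state has exactly one outgoing edge for every
digit. It is a finite automaton when `σ` is finite. -/
structure OutputAutomaton (k : ℕ) (σ A : Type*) where
  /-- The state reached from a given state by reading a digit. -/
  step : σ → Fin k → σ
  /-- The initial state. -/
  start : σ
  /-- The output attached to a state. -/
  out : σ → A

namespace OutputAutomaton

/-- The state reached from `s` by reading the word `w` from left to right. -/
def run {k : ℕ} {σ A : Type*} (M : OutputAutomaton k σ A) (s : σ) (w : List (Fin k)) : σ :=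
  w.foldl M.step s

/-- `w` is a synchronizing word: reading `w` leads to one and the same state `t`,
whichever state the automaton was started in. -/
def IsSynchronizingWord {k : ℕ} {σ A : Type*} (M : OutputAutomaton k σ A)
    (w : List (Fin k)) : Prop :=
  ∃ t : σ, ∀ s : σ, M.run s w = t

end OutputAutomaton

/-- The base-`k` expansion of `n`, most significant digit first and without leading zeros
(the expansion of `0` is the empty word), as a word over `{0, …, k - 1}`. -/
def digitWord (k : ℕ) (hk : 2 ≤ k) (n : ℕ) : List (Fin k) :=
  (Nat.digits k n).reverse.pmap Fin.mk
    (fun _ hd => Nat.digits_lt_base hk (List.mem_reverse.mp hd))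

/-- `M` generates the sequence `a`: the output of `M` after reading the base-`k` expansion of
`n` is `a n`. -/
def OutputAutomaton.Generates {k : ℕ} {σ A : Type*} (M : OutputAutomaton k σ A) (hk : 2 ≤ k)
    (a : ℕ → A) : Prop :=
  ∀ n : ℕ, a n = M.out (M.run M.start (digitWord k hk n))

/-- `a` is a synchronizing `k`-automatic sequence: it is generated by a finite automaton that
has a synchronizing word. The automaton is not required to be minimal; this is the weakest form
of the definition: if the minimal automaton of `a` has a synchronizing word, then the condition
holds with that automaton, and conversely a synchronizing word survives when passing to the
reachable states and identifying states that cannot be distinguished by their outputs. -/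
def IsSynchronizingAutomatic {A : Type*} (k : ℕ) (hk : 2 ≤ k) (a : ℕ → A) : Prop :=
  ∃ (σ : Type) (_ : Finite σ) (M : OutputAutomaton k σ A),
    M.Generates hk a ∧ ∃ w : List (Fin k), M.IsSynchronizingWord w

/-- The set of the words `(a n, a (n + 1), …, a (n + H - 1))`, `n ≥ 0`. -/
def subwords {A : Type*} (a : ℕ → A) (H : ℕ) : Set (Fin H → A) :=
  Set.range fun (n : ℕ) (i : Fin H) => a (n + i)

/-- The subword complexity of `a`: the number of different words of length `H` occurring in `a`.
(For a sequence with finitely many values, the set counted is finite.) -/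
noncomputable def subwordComplexity {A : Type*} (a : ℕ → A) (H : ℕ) : ℕ :=
  (subwords a H).ncard

/-- `a` is deterministic: it takes finitely many values, and its subword complexity `N_H` is
subexponential, that is, `log N_H / H` tends to `0` as `H` tends to infinity. -/
def IsDeterministic {A : Type*} (a : ℕ → A) : Prop :=
  (Set.range a).Finite ∧
    Tendsto (fun H : ℕ => Real.log (subwordComplexity a H : ℝ) / (H : ℝ)) atTop (𝓝 0)

open Polynomial
open scoped fwdDiff

/-! Synchronization means that the last `m` digits of an integer determine the state `f` after
reading it, except for a set of bad residues modulo `k ^ m` whose proportion is as small as desired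
for suitable `m` (`exists_card_badResidues_le`). With `K = k ^ m`, a word `f ⌊(n + h) ^ c⌋`, `h <
ℓ`, is therefore known from the residues modulo `K` of the integer parts, up to a free choice of
state at the bad positions. It remains to see that there are few residue words and few bad
positions.

Few residue words: for `D > c` the `D`-th differences of `h ↦ (n + h) ^ c` are small for large `n`,
and those of the difference of two such sequences have constant sign. By a discrete Rolle theorem
two such sequences, even after subtracting polynomials of degree less than `D`, change order
boundedly often. Their subgraphs then have bounded VC dimension, and Sauer–Shelah gives a polynomial
bound in `ℓ` (`exists_card_floor_mod_words_le`).

Few bad positions: locally `(n + h) ^ c / K` is almost a polynomial in `h`. Weyl's theorem, uniform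
over polynomials of bounded degree (`weyl_dichotomy`), and compactness give two cases for large `n`
(`exists_small_sums_or_near_rational`). Either some window of bounded length starting at `n` has
small exponential sums, and then bad residues are rare (`card_filter_floor_fract_le`). Or, on a
window of prescribed length, the sequence is close to a polynomial whose nonconstant coefficients
are rational with bounded denominator. Along progressions its integer parts, before division by `K`,
are then values of integer polynomials up to an offset 0, 1 or 2. For an integer polynomial `R = r +
k ^ L * R'`, the last `L` digits act as one of finitely many maps of the state set, and `R'` hits
bad residues rarely by Weyl sums modulo a power of `k` (`eventually_card_polynomial_words_le`).

Thus from every large `n` starts a window of bounded length `ℓ` whose word lies in a set of size at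
most `exp (ε * ℓ)`. Concatenating windows bounds the complexity (`exists_card_factorWords_le`). -/

/-! ### Reading final digits and synchronization -/

/-- The state reached from `s` by reading `j` digits, namely the last `j` base-`k` digits of `r`,
most significant digit first. -/
def readDigits {σ : Type*} (k : ℕ) (step : σ → ℕ → σ) : ℕ → ℕ → σ → σ
  | 0, _, s => s
  | j + 1, r, s => step (readDigits k step j (r / k) s) (r % k)

section ReadDigits

variable {σ : Type*} {k : ℕ} {step : σ → ℕ → σ}

theorem readDigits_add (i j r : ℕ) (s : σ) :
    readDigits k step (i + j) r s = readDigits k step j r (readDigits k step i (r / k ^ j) s) := by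
  induction j generalizing r with
  | zero => simp [readDigits]
  | succ j ih =>
    rw [← add_assoc, readDigits, ih, readDigits, Nat.div_div_eq_div_mul, ← pow_succ']

theorem readDigits_mod (j r : ℕ) (s : σ) :
    readDigits k step j (r % k ^ j) s = readDigits k step j r s := by
  induction j generalizing r with
  | zero => rfl
  | succ j ih =>
    rw [readDigits, readDigits, ← ih (r / k), Nat.mod_mod_of_dvd _ (dvd_pow_self k j.succ_ne_zero),
      pow_succ', Nat.mod_mul_right_div_self]

theorem apply_eq_readDigits (hk : 0 < k) {f : ℕ → σ}
    (hf : ∀ n d, d < k → f (k * n + d) = step (f n) d) (j x : ℕ) :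
    f x = readDigits k step j x (f (x / k ^ j)) := by
  induction j generalizing x with
  | zero => simp [readDigits]
  | succ j ih =>
    conv_lhs => rw [← Nat.div_add_mod x k, hf _ _ (Nat.mod_lt _ hk), ih (x / k)]
    rw [readDigits, Nat.div_div_eq_div_mul, ← pow_succ']

variable (k step) in
open Classical in
/-- The residues modulo `k ^ m` for which reading the last `m` digits does not synchronize. -/
noncomputable def badResidues (m : ℕ) : Finset ℕ :=
  (Finset.range (k ^ m)).filter fun r =>
    ∃ s s', readDigits k step m r s ≠ readDigits k step m r s'

theorem readDigits_eq_of_not_mem_badResidues (hk : 0 < k) {m r : ℕ}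
    (hr : r % k ^ m ∉ badResidues k step m) (s s' : σ) :
    readDigits k step m r s = readDigits k step m r s' := by
  by_contra h
  apply hr
  simp only [badResidues, Finset.mem_filter, Finset.mem_range]
  exact ⟨Nat.mod_lt _ (pow_pos hk m), s, s', by rwa [readDigits_mod, readDigits_mod]⟩

-- Cut the `q * j` digits into `q` blocks of length `j`. One block equal to the synchronizing block
-- `v` merges all states, so a bad residue has at most `k ^ j - 1` choices for each block.
open Classical in
theorem card_badResidues_le (hk : 0 < k) {j v : ℕ} (hv : v < k ^ j)
    (hsync : ∀ s s', readDigits k step j v s = readDigits k step j v s') (q : ℕ) :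
    (badResidues k step (q * j)).card ≤ (k ^ j - 1) ^ q := by
  induction q with
  | zero =>
    rw [zero_mul, pow_zero]
    refine (Finset.card_le_card (Finset.filter_subset _ _)).trans (by simp)
  | succ q ih =>
    have hkj : 0 < k ^ j := pow_pos hk j
    calc (badResidues k step ((q + 1) * j)).card
        ≤ (badResidues k step (q * j) ×ˢ ((Finset.range (k ^ j)).erase v)).card := by
          apply Finset.card_le_card_of_injOn (fun r => (r / k ^ j, r % k ^ j))
          · intro r hr
            simp only [badResidues, Finset.coe_filter, Finset.mem_range, Set.mem_ofPred_eq] at hr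
            obtain ⟨hr, s, s', hne⟩ := hr
            rw [add_mul, one_mul, readDigits_add, readDigits_add] at hne
            simp only [badResidues, Finset.coe_product, Finset.coe_filter, Finset.coe_erase,
              Finset.mem_range, Finset.coe_range, Set.mem_prod, Set.mem_ofPred_eq, Set.mem_sdiff,
              Set.mem_Iio, Set.mem_singleton_iff]
            refine ⟨⟨?_, s, s', fun h => hne (by rw [h])⟩, Nat.mod_lt _ hkj, fun h => hne ?_⟩
            · rw [Nat.div_lt_iff_lt_mul hkj, ← pow_add]
              rwa [add_mul, one_mul] at hr
            · rw [← readDigits_mod j r, ← readDigits_mod j r, h]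
              exact hsync _ _
          · intro r _ r' _ h
            simp only [Prod.mk.injEq] at h
            rw [← Nat.div_add_mod r (k ^ j), ← Nat.div_add_mod r' (k ^ j), h.1, h.2]
      _ ≤ (k ^ j - 1) ^ q * (k ^ j - 1) := by
          rw [Finset.card_product, Finset.card_erase_of_mem (Finset.mem_range.2 hv),
            Finset.card_range]
          exact Nat.mul_le_mul_right _ ih
      _ = _ := (pow_succ _ _).symm

theorem exists_card_badResidues_le (hk : 2 ≤ k) {j v : ℕ} (hj : 0 < j) (hv : v < k ^ j)
    (hsync : ∀ s s', readDigits k step j v s = readDigits k step j v s') {δ : ℝ} (hδ : 0 < δ) :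
    ∃ m, 6 ≤ k ^ m ∧ ((badResidues k step m).card : ℝ) ≤ δ * (k : ℝ) ^ m := by
  have hkj : (0 : ℝ) < (k : ℝ) ^ j := by positivity
  have hlt : ((k : ℝ) ^ j - 1) / (k : ℝ) ^ j < 1 := by
    rw [div_lt_one hkj]; linarith
  have hone : (1 : ℝ) ≤ (k : ℝ) ^ j := one_le_pow₀ (by exact_mod_cast (by omega : 1 ≤ k))
  have hnonneg : 0 ≤ ((k : ℝ) ^ j - 1) / (k : ℝ) ^ j := div_nonneg (by linarith) hkj.le
  have h := (tendsto_pow_atTop_nhds_zero_of_lt_one hnonneg hlt).eventually (gt_mem_nhds hδ)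
  -- `q ≥ 3` makes the modulus at least `2 ^ 3`, hence at least 6, as the equidistribution estimate
  -- requires.
  obtain ⟨q, hq, hq3⟩ := (h.and (eventually_ge_atTop 3)).exists
  refine ⟨q * j, ?_, ?_⟩
  · calc 6 ≤ 2 ^ 3 := by norm_num
      _ ≤ 2 ^ (q * j) := Nat.pow_le_pow_right (by norm_num) (by nlinarith)
      _ ≤ k ^ (q * j) := Nat.pow_le_pow_left hk _
  · have h1 : ((badResidues k step (q * j)).card : ℝ) ≤ ((k : ℝ) ^ j - 1) ^ q := by
      have := card_badResidues_le (step := step) (by omega : 0 < k) hv hsync q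
      have h2 : ((badResidues k step (q * j)).card : ℝ) ≤ (((k ^ j - 1) ^ q : ℕ) : ℝ) := by
        exact_mod_cast this
      rwa [Nat.cast_pow, Nat.cast_sub (Nat.one_le_pow _ _ (by omega)), Nat.cast_pow,
        Nat.cast_one] at h2
    rw [div_pow, div_lt_iff₀ (by positivity), ← pow_mul, mul_comm j q] at hq
    linarith

end ReadDigits

/-- The state sequence of an automaton, with an additional initial state that ignores leading
zeros. -/
theorem IsSynchronizingAutomatic.exists_states {A : Type*} {k : ℕ} (hk : 2 ≤ k) {a : ℕ → A}
    (ha : IsSynchronizingAutomatic k hk a) :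
    ∃ (τ : Type) (_ : Finite τ) (step : τ → ℕ → τ) (f : ℕ → τ) (out : τ → A) (j v : ℕ),
      (∀ n d, d < k → f (k * n + d) = step (f n) d) ∧ (∀ n, a n = out (f n)) ∧
      0 < j ∧ v < k ^ j ∧ ∀ s s', readDigits k step j v s = readDigits k step j v s' := by
  classical
  obtain ⟨σ, hσ, M, hgen, w, t, hw⟩ := ha
  have hk0 : 0 < k := by omega
  let stp : σ → ℕ → σ := fun s d => M.step s ⟨d % k, Nat.mod_lt _ hk0⟩
  -- `none` absorbs leading zeros and behaves like `M.start` on any other digit. With `f 0 = none`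
  -- the recursion `f (k * n + d) = step (f n) d` holds at 0 too.
  let step : Option σ → ℕ → Option σ := fun s d =>
    if s = none ∧ d = 0 then none else some (stp (s.getD M.start) d)
  let f : ℕ → Option σ := fun n =>
    if n = 0 then none else some (M.run M.start (digitWord k hk n))
  have hsome : ∀ (s : σ) d, step (some s) d = some (stp s d) := fun s d => by simp [step]
  have hdig : ∀ n d, d < k → 0 < k * n + d →
      M.run M.start (digitWord k hk (k * n + d)) = stp (M.run M.start (digitWord k hk n)) d := by
    intro n d hd hpos
    have h1 : Nat.digits k (k * n + d) = d :: Nat.digits k n := by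
      rw [add_comm]
      rcases Nat.eq_zero_or_pos n with rfl | hn
      · exact Nat.digits_add k hk d 0 hd (Or.inl (by simpa using hpos.ne'))
      · exact Nat.digits_add k hk d n hd (Or.inr hn.ne')
    have h2 : digitWord k hk (k * n + d) = digitWord k hk n ++ [⟨d, hd⟩] := by
      unfold digitWord
      simp [h1, List.pmap_append]
    rw [h2, OutputAutomaton.run, OutputAutomaton.run, List.foldl_append]
    simp [stp, Nat.mod_eq_of_lt hd]
  have hrun : ∀ u : List (Fin k), ∃ v, v < k ^ u.length ∧
      ∀ s : σ, readDigits k step u.length v (some s) = some (M.run s u) := by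
    intro u
    induction u using List.reverseRecOn with
    | nil => exact ⟨0, by simp, fun s => rfl⟩
    | append_singleton u x ih =>
      obtain ⟨v, hv, ih⟩ := ih
      refine ⟨k * v + x, ?_, fun s => ?_⟩
      · rw [List.length_append, List.length_singleton, pow_succ']
        have := x.2
        nlinarith
      · rw [List.length_append, List.length_singleton, readDigits, Nat.mul_add_div hk0,
          Nat.div_eq_of_lt x.2, add_zero, ih, hsome, Nat.mul_add_mod,
          Nat.mod_eq_of_lt x.2, OutputAutomaton.run, OutputAutomaton.run, List.foldl_append]
        simp [stp, Nat.mod_eq_of_lt x.2]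
  obtain ⟨v, hv, hread⟩ := hrun w
  -- The new synchronizing word is the digit 1 followed by `w`: the digit 1 forces the automaton out
  -- of `none`.
  refine ⟨Option σ, inferInstance, step, f, fun s => M.out (s.getD M.start), 1 + w.length,
    k ^ w.length + v, ?_, ?_, by omega, ?_, ?_⟩
  · intro n d hd
    rcases Nat.eq_zero_or_pos (k * n + d) with h | h
    · have hd0 : d = 0 := by omega
      have hn0 : n = 0 := by
        rcases Nat.eq_zero_or_pos n with h' | h'
        · exact h'
        · have := Nat.mul_pos hk0 h'
          omega
      subst hd0 hn0
      simp [f, step]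
    · simp only [f, h.ne', if_false, hdig n d hd h]
      rcases Nat.eq_zero_or_pos n with rfl | hn
      · have hd0 : d ≠ 0 := by simpa using h.ne'
        simp [step, hd0, digitWord, OutputAutomaton.run]
      · simp [hn.ne', hsome]
  · intro n
    rw [hgen n]
    rcases Nat.eq_zero_or_pos n with rfl | hn
    · simp [f, digitWord, OutputAutomaton.run]
    · simp [f, hn.ne']
  · rw [pow_add, pow_one]
    nlinarith [pow_pos hk0 w.length]
  · have key : ∀ s, readDigits k step (1 + w.length) (k ^ w.length + v) s = some t := by
      intro s
      have h1 : (k ^ w.length + v) / k ^ w.length = 1 := by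
        rw [Nat.add_div_left _ (pow_pos hk0 _), Nat.div_eq_of_lt hv]
      have h2 : (k ^ w.length + v) % k ^ w.length = v := by
        rw [Nat.add_mod_left, Nat.mod_eq_of_lt hv]
      have h3 : readDigits k step 1 1 s = some (stp (s.getD M.start) 1) := by
        simp [readDigits, step, Nat.mod_eq_of_lt (show 1 < k by omega)]
      rw [readDigits_add, h1, ← readDigits_mod, h2, h3, hread, hw]
    intro s s'
    rw [key, key]

/-! ### Sign changes, VC dimension and words of integer parts -/

/-- `φ` takes values of strictly alternating signs at `s` increasing arguments, the first of which
has the sign of `ε`. -/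
def AlternatesSign (φ : ℕ → ℝ) (s : ℕ) (ε : ℝ) : Prop :=
  ∃ x : ℕ → ℕ, (∀ i < s, 0 < ε * (-1) ^ i * φ (x i)) ∧ ∀ i, i + 1 < s → x i < x (i + 1)

theorem exists_fwdDiff_pos {ψ : ℕ → ℝ} {x y : ℕ} (hx : ψ x < 0) (hy : 0 < ψ y) (h : x < y) :
    ∃ z, x ≤ z ∧ z < y ∧ 0 < Δ_[1] ψ z := by
  by_contra! hcon
  have : ∀ z, x ≤ z → z ≤ y → ψ z ≤ ψ x := by
    intro z hz
    induction z, hz using Nat.le_induction with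
    | base => intro _; exact le_rfl
    | succ z hz ih =>
      intro hzy
      have h1 := hcon z hz (by omega)
      rw [fwdDiff] at h1
      linarith [ih (by omega)]
  linarith [this y h.le le_rfl]

/-- Discrete version of Rolle's theorem. -/
theorem AlternatesSign.fwdDiff {φ : ℕ → ℝ} {s : ℕ} {ε : ℝ} (h : AlternatesSign φ (s + 1) ε) :
    AlternatesSign (Δ_[1] φ) s (-ε) := by
  obtain ⟨x, hx, hlt⟩ := h
  have : ∀ i, ∃ y, i < s → x i ≤ y ∧ y < x (i + 1) ∧ 0 < -ε * (-1) ^ i * Δ_[1] φ y := by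
    intro i
    by_cases hi : i < s
    · obtain ⟨z, h1, h2, h3⟩ := exists_fwdDiff_pos (ψ := fun y => -ε * (-1) ^ i * φ y)
        (x := x i) (y := x (i + 1)) (by have := hx i (by omega); linarith)
        (by have := hx (i + 1) (by omega); rw [pow_succ] at this; linarith) (hlt i (by omega))
      refine ⟨z, fun _ => ⟨h1, h2, ?_⟩⟩
      simp only [_root_.fwdDiff] at h3 ⊢
      linarith
    · exact ⟨0, fun h => absurd h hi⟩
  choose y hy using this
  refine ⟨y, fun i hi => (hy i hi).2.2, fun i hi => ?_⟩
  exact (hy i (by omega)).2.1.trans_le (hy (i + 1) hi).1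

theorem AlternatesSign.fwdDiff_iter {φ : ℕ → ℝ} {s d : ℕ} {ε : ℝ}
    (h : AlternatesSign φ (s + d) ε) : AlternatesSign (Δ_[1] ^[d] φ) s ((-1) ^ d * ε) := by
  induction d generalizing φ ε with
  | zero => simpa using h
  | succ d ih =>
    have := ih (h.fwdDiff (s := s + d))
    rw [Function.iterate_succ_apply]
    convert this using 1
    rw [pow_succ]; ring

/-- The weak sign condition bounds the number of sign changes. -/
theorem AlternatesSign.lt_of_fwdDiff_iter {φ : ℕ → ℝ} {s d : ℕ} {ε : ℝ}
    (h : AlternatesSign φ s ε)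
    (hd : (∀ x, 0 ≤ Δ_[1] ^[d] φ x) ∨ ∀ x, Δ_[1] ^[d] φ x ≤ 0) : s < d + 2 := by
  by_contra! hs
  obtain ⟨m, rfl⟩ : ∃ m, s = m + 2 + d := ⟨s - d - 2, by omega⟩
  obtain ⟨x, hx, -⟩ := h.fwdDiff_iter
  have h0 := hx 0 (by omega)
  have h1 := hx 1 (by omega)
  simp only [pow_zero, mul_one, pow_one] at h0 h1
  rcases hd with hd | hd
  · have a0 := hd (x 0); have a1 := hd (x 1)
    have b0 : 0 < (-1) ^ d * ε := by
      by_contra! hc; nlinarith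
    nlinarith
  · have a0 := hd (x 0); have a1 := hd (x 1)
    have b0 : (-1) ^ d * ε < 0 := by
      by_contra! hc; nlinarith
    nlinarith

/-- The family of the subgraphs `{(h, v) | v < ⌊φ h⌋}` of the functions in `F`. -/
noncomputable def subgraphs (F : Set (ℕ → ℝ)) (ℓ V : ℕ) : Finset (Finset (Fin ℓ × Fin V)) :=
  open Classical in
  Finset.univ.filter fun S => ∃ φ ∈ F, S = Finset.univ.filter fun p => (p.2 : ℕ) < ⌊φ p.1⌋₊

/-- Subgraphs are closed downwards, so a shattered set has at most one point in each column. Order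
its points by column; some `φ` picks out exactly the even-numbered points and some `ψ` the
odd-numbered ones. Then `φ - ψ` alternates in sign at all of them, and Rolle bounds their number. -/
theorem vcDim_subgraphs_le {F : Set (ℕ → ℝ)} {d : ℕ}
    (hF : ∀ φ ∈ F, ∀ ψ ∈ F, (∀ x, 0 ≤ Δ_[1] ^[d] (φ - ψ) x) ∨ ∀ x, Δ_[1] ^[d] (φ - ψ) x ≤ 0)
    (ℓ V : ℕ) : (subgraphs F ℓ V).vcDim ≤ d + 1 := by
  classical
  refine Finset.sup_le fun X hX => ?_
  rw [Finset.mem_shatterer] at hX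
  have hX' : ∀ t ⊆ X, ∃ φ ∈ F, ∀ p ∈ X, p ∈ t ↔ (p.2 : ℕ) < ⌊φ p.1⌋₊ := by
    intro t ht
    obtain ⟨u, hu, hut⟩ := hX ht
    simp only [subgraphs, Finset.mem_filter, Finset.mem_univ, true_and] at hu
    obtain ⟨φ, hφ, rfl⟩ := hu
    refine ⟨φ, hφ, fun p hp => ?_⟩
    rw [← hut]
    simp [hp]
  have hinj : Set.InjOn Prod.fst (X : Set (Fin ℓ × Fin V)) := by
    have key : ∀ p ∈ X, ∀ q ∈ X, p.1 = q.1 → ¬ (p.2 : ℕ) < q.2 := by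
      intro p hp q hq hpq hlt
      obtain ⟨φ, -, hφ⟩ := hX' {q} (Finset.singleton_subset_iff.2 hq)
      have h1 := (hφ q hq).1 (Finset.mem_singleton_self q)
      have h2 := (hφ p hp).2 (by rw [hpq]; omega)
      rw [Finset.mem_singleton] at h2
      rw [h2] at hlt
      exact lt_irrefl _ hlt
    intro p hp q hq hpq
    refine Prod.ext hpq (Fin.ext ?_)
    have := key p hp q hq hpq
    have := key q hq p hp hpq.symm
    omega
  set Y := X.image Prod.fst with hY
  have hcard : Y.card = X.card := Finset.card_image_of_injOn hinj
  rw [← hcard]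
  let e := Y.orderEmbOfFin rfl
  have hv : ∀ i : Fin Y.card, ∃ v, (e i, v) ∈ X := by
    intro i
    have : e i ∈ Y := Y.orderEmbOfFin_mem rfl i
    obtain ⟨p, hp, h⟩ := Finset.mem_image.1 this
    exact ⟨p.2, by rw [← h]; exact hp⟩
  choose v hv using hv
  have hpar : ∀ b : ℕ, ∃ φ ∈ F, ∀ i : Fin Y.card, (i : ℕ) % 2 = b ↔ (v i : ℕ) < ⌊φ (e i)⌋₊ := by
    intro b
    obtain ⟨φ, hφ, h⟩ := hX' (X.filter fun p => ∃ i : Fin Y.card, e i = p.1 ∧ (i : ℕ) % 2 = b)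
      (Finset.filter_subset _ _)
    refine ⟨φ, hφ, fun i => ?_⟩
    rw [← h _ (hv i), Finset.mem_filter]
    constructor
    · intro hi
      exact ⟨hv i, i, rfl, hi⟩
    · rintro ⟨-, j, hj, hjb⟩
      rwa [← e.injective hj]
  obtain ⟨φ, hφ, hφ'⟩ := hpar 0
  obtain ⟨ψ, hψ, hψ'⟩ := hpar 1
  have hpos : ∀ (χ : ℕ → ℝ) (i : Fin Y.card), (v i : ℕ) < ⌊χ (e i)⌋₊ ↔
      ((v i : ℕ) : ℝ) + 1 ≤ χ (e i) := by
    intro χ i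
    rw [← Nat.succ_le_iff, Nat.le_floor_iff' (Nat.succ_ne_zero _)]
    push_cast
    rfl
  -- At height `v`, one function is at least `v + 1` and the other is below `v + 1`, so the sign is
  -- strict.
  have halt : AlternatesSign (φ - ψ) Y.card 1 := by
    refine ⟨fun i => if h : i < Y.card then e ⟨i, h⟩ else 0, fun i hi => ?_, fun i hi => ?_⟩
    · simp only [hi, dif_pos, Pi.sub_apply]
      have h1 := hφ' ⟨i, hi⟩
      have h2 := hψ' ⟨i, hi⟩
      rw [hpos] at h1 h2
      rcases Nat.mod_two_eq_zero_or_one i with h | h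
      · rw [(Nat.even_iff.2 h).neg_one_pow]
        have h3 := h1.1 h
        have h4 := mt h2.2 (by simp [h])
        linarith
      · rw [(Nat.odd_iff.2 h).neg_one_pow]
        have h3 := mt h1.2 (by simp [h])
        have h4 := h2.1 h
        linarith
    · simp only [hi, (Nat.lt_succ_self i).trans hi, dif_pos]
      have : e ⟨i, (Nat.lt_succ_self i).trans hi⟩ < e ⟨i + 1, hi⟩ :=
        e.strictMono (by simp [Fin.lt_def])
      exact this
  have := halt.lt_of_fwdDiff_iter (hF φ hφ ψ hψ)
  omega

/-- The Sauer–Shelah lemma turns the VC bound into a polynomial bound. -/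
theorem card_subgraphs_le {F : Set (ℕ → ℝ)} {d : ℕ}
    (hF : ∀ φ ∈ F, ∀ ψ ∈ F, (∀ x, 0 ≤ Δ_[1] ^[d] (φ - ψ) x) ∨ ∀ x, Δ_[1] ^[d] (φ - ψ) x ≤ 0)
    (ℓ V : ℕ) : (subgraphs F ℓ V).card ≤ (d + 2) * (ℓ * V + 1) ^ (d + 1) := by
  classical
  refine (Finset.card_le_card_shatterer _).trans (Finset.card_shatterer_le_sum_vcDim.trans ?_)
  have h := vcDim_subgraphs_le hF ℓ V
  calc ∑ i ∈ Finset.Iic (subgraphs F ℓ V).vcDim, (Fintype.card (Fin ℓ × Fin V)).choose i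
      ≤ ∑ i ∈ Finset.Iic (d + 1), (ℓ * V + 1) ^ (d + 1) := by
        refine (Finset.sum_le_sum_of_subset (Finset.Iic_subset_Iic.2 h)).trans
          (Finset.sum_le_sum fun i hi => ?_)
        rw [Finset.mem_Iic] at hi
        simp only [Fintype.card_prod, Fintype.card_fin]
        calc (ℓ * V).choose i ≤ (ℓ * V) ^ i := Nat.choose_le_pow _ _
          _ ≤ (ℓ * V + 1) ^ i := Nat.pow_le_pow_left (Nat.le_succ _) _
          _ ≤ _ := Nat.pow_le_pow_right (Nat.succ_pos _) hi
    _ = _ := by simp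

/-- The number of words `⌊φ h⌋`, `h < ℓ`, with `φ ∈ F`, is bounded polynomially. -/
theorem exists_card_floor_words_le {F : Set (ℕ → ℝ)} {d : ℕ}
    (hF : ∀ φ ∈ F, ∀ ψ ∈ F, (∀ x, 0 ≤ Δ_[1] ^[d] (φ - ψ) x) ∨ ∀ x, Δ_[1] ^[d] (φ - ψ) x ≤ 0)
    (ℓ V : ℕ) (hV : ∀ φ ∈ F, ∀ h < ℓ, φ h < V) :
    ∃ S : Finset (Fin ℓ → ℕ), S.card ≤ (d + 2) * (ℓ * V + 1) ^ (d + 1) ∧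
      ∀ φ ∈ F, (fun h : Fin ℓ => ⌊φ h⌋₊) ∈ S := by
  classical
  -- The integer part at `h` is the height of column `h` of the subgraph.
  refine ⟨(subgraphs F ℓ V).image fun S h => (Finset.univ.filter fun v => (h, v) ∈ S).card,
    Finset.card_image_le.trans (card_subgraphs_le hF ℓ V), fun φ hφ => ?_⟩
  rw [Finset.mem_image]
  refine ⟨Finset.univ.filter fun p => (p.2 : ℕ) < ⌊φ p.1⌋₊, ?_, ?_⟩
  · simp only [subgraphs, Finset.mem_filter, Finset.mem_univ, true_and]
    exact ⟨φ, hφ, rfl⟩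
  · funext h
    have hlt : ⌊φ h⌋₊ ≤ V := by
      rw [← Nat.floor_natCast (R := ℝ) V]
      exact Nat.floor_le_floor (hV φ hφ h h.2).le
    simp [Fin.card_filter_val_lt, hlt]

/-- A sequence with small `d`-th differences is close to `K` times an integer-valued polynomial
sequence. -/
theorem exists_int_seq_near {d : ℕ} {K B : ℝ} (hK : 0 < K) (hB : 0 ≤ B) (ℓ : ℕ) {u : ℕ → ℝ}
    (hu : ∀ x, |Δ_[1] ^[d] u x| ≤ B) :
    ∃ Z : ℕ → ℤ, (∀ x, Δ_[1] ^[d] (fun h => K * (Z h : ℝ)) x = 0) ∧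
      ∀ h ≤ ℓ, |u h - K * Z h| ≤ (K + B) * (ℓ + 1) ^ d := by
  induction d generalizing u with
  | zero =>
    refine ⟨0, by simp, fun h _ => ?_⟩
    have := hu h
    simp only [Function.iterate_zero, id] at this
    simp
    linarith
  | succ d ih =>
    obtain ⟨Z, hZ0, hZ⟩ := ih (u := Δ_[1] u) (by simpa [Function.iterate_succ_apply] using hu)
    -- Sum the approximation of `Δ u`, starting from `u 0 / K` rounded down; the rounding costs at
    -- most `K`, and each summation at most a factor `ℓ`.
    refine ⟨fun h => ⌊u 0 / K⌋ + ∑ i ∈ Finset.range h, Z i, fun x => ?_, fun h hh => ?_⟩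
    · rw [Function.iterate_succ_apply]
      convert hZ0 x using 2
      funext h
      simp [fwdDiff, Finset.sum_range_succ]
      ring
    · have hrec : ∀ h ≤ ℓ, |u h - K * ((⌊u 0 / K⌋ + ∑ i ∈ Finset.range h, Z i : ℤ) : ℝ)| ≤
          K + h * ((K + B) * (ℓ + 1) ^ d) := by
        intro h
        induction h with
        | zero =>
          intro _
          have h1 := Int.floor_le (u 0 / K)
          have h2 := Int.lt_floor_add_one (u 0 / K)
          rw [le_div_iff₀ hK] at h1
          rw [div_lt_iff₀ hK] at h2
          simp
          rw [abs_le]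
          constructor <;> linarith
        | succ h ihh =>
          intro hle
          have h1 := ihh (by omega)
          have h2 := hZ h (by omega)
          have e1 : u (h + 1) - K * ((⌊u 0 / K⌋ + ∑ i ∈ Finset.range (h + 1), Z i : ℤ) : ℝ) =
              (u h - K * ((⌊u 0 / K⌋ + ∑ i ∈ Finset.range h, Z i : ℤ) : ℝ)) +
              (Δ_[1] u h - K * Z h) := by
            rw [Finset.sum_range_succ, fwdDiff]
            push_cast
            ring
          rw [e1]
          refine (abs_add_le _ _).trans ?_
          push_cast at h1 ⊢
          linarith
      refine (hrec h hh).trans ?_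
      have h1 : (1 : ℝ) ≤ (ℓ + 1) ^ d := one_le_pow₀ (by linarith [Nat.cast_nonneg (α := ℝ) ℓ])
      have h2 : (h : ℝ) ≤ ℓ := by exact_mod_cast hh
      have h3 : 0 ≤ (K + B) * ((ℓ : ℝ) + 1) ^ d := by positivity
      rw [pow_succ]
      nlinarith [mul_le_mul_of_nonneg_right h2 h3]

/-- The number of words formed by the residues of integer parts of a family of sequences is bounded
polynomially. -/
theorem exists_card_floor_mod_words_le (d K : ℕ) (hK : 0 < K) :
    ∃ C : ℕ, ∀ F : Set (ℕ → ℝ), (∀ φ ∈ F, ∀ x, 0 ≤ φ x) → (∀ φ ∈ F, ∀ x, |Δ_[1] ^[d] φ x| ≤ 1) →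
      (∀ φ ∈ F, ∀ ψ ∈ F, (∀ x, 0 ≤ Δ_[1] ^[d] (φ - ψ) x) ∨ ∀ x, Δ_[1] ^[d] (φ - ψ) x ≤ 0) →
      ∀ ℓ : ℕ, ∃ S : Finset (Fin ℓ → ℕ), S.card ≤ C * (ℓ + 1) ^ ((d + 1) * (d + 1)) ∧
        ∀ φ ∈ F, (fun h : Fin ℓ => ⌊φ h⌋₊ % K) ∈ S := by
  classical
  refine ⟨(d + 2) * ((K + 1) ^ 2 + 1) ^ (d + 1), fun F hpos hF hFF ℓ => ?_⟩
  have hK' : (0 : ℝ) < K := by exact_mod_cast hK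
  have hex : ∀ φ : F, ∃ Z : ℕ → ℤ, (∀ x, Δ_[1] ^[d] (fun h => (K : ℝ) * (Z h : ℝ)) x = 0) ∧
      ∀ h ≤ ℓ, |φ.1 h - K * Z h| ≤ (K + 1) * (ℓ + 1) ^ d := fun φ =>
    exists_int_seq_near hK' zero_le_one ℓ (hF φ.1 φ.2)
  choose Z hZ0 hZ using hex
  set V₁ : ℕ := (K + 1) * (ℓ + 1) ^ d with hV₁
  set V : ℕ := (K + 1) * V₁ + 1 with hV
  -- Both corrections are multiples of `K`, so residues are unchanged. Subtracting `K * Z` confines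
  -- `φ` to a range polynomial in `ℓ` without affecting `d`-th differences; the shift by `K * V₁`
  -- makes `g` nonnegative on the window.
  let g : F → ℕ → ℝ := fun φ h => φ.1 h - K * Z φ h + K * V₁
  have hV₁' : ((K : ℝ) + 1) * (ℓ + 1) ^ d = V₁ := by rw [hV₁]; push_cast; rfl
  have hK1 : (1 : ℝ) ≤ K := by exact_mod_cast hK
  have hg : ∀ φ : F, ∀ h < ℓ, 0 ≤ g φ h ∧ g φ h < V := by
    intro φ h hh
    have h1 := hZ φ h hh.le
    rw [hV₁', abs_le] at h1
    have h2 : (V₁ : ℝ) ≤ K * V₁ := le_mul_of_one_le_left (Nat.cast_nonneg _) hK1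
    simp only [g, hV]
    push_cast
    constructor <;> linarith [h1.1, h1.2]
  have hGG : ∀ φ ∈ Set.range g, ∀ ψ ∈ Set.range g,
      (∀ x, 0 ≤ Δ_[1] ^[d] (φ - ψ) x) ∨ ∀ x, Δ_[1] ^[d] (φ - ψ) x ≤ 0 := by
    rintro _ ⟨φ, rfl⟩ _ ⟨ψ, rfl⟩
    have e1 : g φ - g ψ = (φ.1 - ψ.1) + ((-1 : ℝ) • (fun h => (K : ℝ) * (Z φ h : ℝ)) +
        fun h => (K : ℝ) * (Z ψ h : ℝ)) := by
      funext h
      simp [g]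
      ring
    have e2 : ∀ x, Δ_[1] ^[d] (g φ - g ψ) x = Δ_[1] ^[d] (φ.1 - ψ.1) x := by
      intro x
      rw [e1, fwdDiff_iter_add, fwdDiff_iter_add, fwdDiff_iter_const_smul]
      simp [hZ0]
    simp only [e2]
    exact hFF φ.1 φ.2 ψ.1 ψ.2
  obtain ⟨S, hS, hSmem⟩ := exists_card_floor_words_le (F := Set.range g ∩ {φ | ∀ h < ℓ, φ h < V})
    (fun φ hφ ψ hψ => hGG φ hφ.1 ψ hψ.1) ℓ V (fun φ hφ => hφ.2)
  refine ⟨S.image fun w h => w h % K, Finset.card_image_le.trans (hS.trans ?_), fun φ hφ => ?_⟩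
  · rw [mul_assoc, pow_mul, ← mul_pow]
    refine Nat.mul_le_mul_left _ (Nat.pow_le_pow_left ?_ _)
    have h1 : 1 ≤ (ℓ + 1) ^ d := Nat.one_le_pow _ _ (Nat.succ_pos _)
    calc ℓ * V + 1 ≤ (ℓ + 1) * V := by
          have : 1 ≤ V := by omega
          nlinarith
      _ ≤ (ℓ + 1) * (((K + 1) ^ 2 + 1) * (ℓ + 1) ^ d) := by
          refine Nat.mul_le_mul_left _ ?_
          rw [hV, hV₁]
          nlinarith
      _ = _ := by ring
  · rw [Finset.mem_image]
    refine ⟨_, hSmem (g ⟨φ, hφ⟩) ⟨⟨_, rfl⟩, fun h hh => (hg _ h hh).2⟩, ?_⟩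
    funext h
    have e1 : ⌊g ⟨φ, hφ⟩ h⌋ = ⌊φ h⌋ + K * (V₁ - Z ⟨φ, hφ⟩ h) := by
      rw [← Int.floor_add_intCast]
      congr 1
      simp only [g]
      push_cast
      ring
    have e2 := Int.natCast_floor_eq_floor (hg ⟨φ, hφ⟩ h h.2).1
    have e3 := Int.natCast_floor_eq_floor (hpos φ hφ h)
    zify
    rw [e2, e3, e1]
    simp

/-! ### Differences of power sequences -/

theorem fwdDiff_iter_natCast (g : ℝ → ℝ) (d h : ℕ) :
    Δ_[1] ^[d] (fun n : ℕ => g n) h = Δ_[(1 : ℝ)] ^[d] g h := by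
  induction d generalizing g with
  | zero => rfl
  | succ d ih =>
    have h1 : Δ_[1] (fun n : ℕ => g n) = fun n : ℕ => Δ_[(1 : ℝ)] g n := by
      funext n
      simp [fwdDiff]
    rw [Function.iterate_succ_apply, Function.iterate_succ_apply, ← ih, h1]

/-- Iterated mean value theorem. -/
theorem exists_fwdDiff_iter_eq_deriv {G : ℕ → ℝ → ℝ}
    (hG : ∀ i, ∀ x, 0 ≤ x → HasDerivAt (G i) (G (i + 1) x) x) (d : ℕ) {x : ℝ} (hx : 0 ≤ x) :
    ∃ ξ, x ≤ ξ ∧ Δ_[(1 : ℝ)] ^[d] (G 0) x = G d ξ := by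
  induction d generalizing G with
  | zero => exact ⟨x, le_rfl, rfl⟩
  | succ d ih =>
    obtain ⟨ξ, hξ, h⟩ := ih (G := fun i => Δ_[(1 : ℝ)] (G i)) (by
      intro i x hx
      have h1 := (hG i (x + 1) (by linarith)).comp_add_const x 1
      exact h1.sub (hG i x hx))
    rw [Function.iterate_succ_apply, h]
    obtain ⟨η, hη, h'⟩ := exists_hasDerivAt_eq_slope (G d) (G (d + 1)) (lt_add_one ξ)
      (fun y hy => (hG d y (by linarith [hy.1])).continuousAt.continuousWithinAt)
      (fun y hy => hG d y (by linarith [hy.1]))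
    refine ⟨η, by linarith [hη.1], ?_⟩
    rw [h', fwdDiff]
    simp

theorem exists_fwdDiff_iter_natCast_eq_deriv {G : ℕ → ℝ → ℝ}
    (hG : ∀ i, ∀ x, 0 ≤ x → HasDerivAt (G i) (G (i + 1) x) x) (d h : ℕ) :
    ∃ ξ : ℝ, 0 ≤ ξ ∧ Δ_[1] ^[d] (fun n : ℕ => G 0 n) h = G d ξ := by
  obtain ⟨ξ, h1, h2⟩ := exists_fwdDiff_iter_eq_deriv hG d (Nat.cast_nonneg h)
  exact ⟨ξ, (Nat.cast_nonneg h).trans h1, by rw [fwdDiff_iter_natCast, h2]⟩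

/-- The derivatives of `x ↦ (n + x) ^ c`. -/
noncomputable def shiftedPow (c n : ℝ) (i : ℕ) (x : ℝ) : ℝ :=
  (∏ j ∈ Finset.range i, (c - j)) * (n + x) ^ (c - i)

theorem hasDerivAt_shiftedPow (c : ℝ) {n : ℝ} (hn : 0 < n) (i : ℕ) {x : ℝ} (hx : 0 ≤ x) :
    HasDerivAt (shiftedPow c n i) (shiftedPow c n (i + 1) x) x := by
  have h1 : HasDerivAt (fun x => n + x) 1 x := (hasDerivAt_id x).const_add n
  have h2 := (h1.rpow_const (p := c - i) (Or.inl (by positivity))).const_mul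
    (∏ j ∈ Finset.range i, (c - j))
  refine h2.congr_deriv ?_
  simp only [shiftedPow, Finset.prod_range_succ]
  push_cast
  ring_nf

/-- The sequence `h ↦ (n + h) ^ c`. -/
noncomputable def powSeq (c : ℝ) (n h : ℕ) : ℝ := ((n : ℝ) + h) ^ c

theorem exists_fwdDiff_iter_powSeq (c : ℝ) {n : ℕ} (hn : 0 < n) (d h : ℕ) :
    ∃ ξ : ℝ, 0 ≤ ξ ∧ Δ_[1] ^[d] (powSeq c n) h =
      (∏ j ∈ Finset.range d, (c - j)) * (n + ξ) ^ (c - d) := by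
  obtain ⟨ξ, h1, h2⟩ := exists_fwdDiff_iter_natCast_eq_deriv (G := shiftedPow c n)
    (fun i x hx => hasDerivAt_shiftedPow c (by exact_mod_cast hn) i hx) d h
  have h3 : powSeq c n = fun k : ℕ => shiftedPow c n 0 k := by
    funext m
    simp [powSeq, shiftedPow]
  exact ⟨ξ, h1, by rw [h3, h2, shiftedPow]⟩

/-- The difference is a fixed multiple of `(n + ξ) ^ (c - d)`, whose exponent is negative; `ξ ≥ 0`
makes the bound uniform in `h`. -/
theorem tendsto_sup_fwdDiff_iter_powSeq (c : ℝ) {d : ℕ} (hd : c < d) {ε : ℝ} (hε : 0 < ε) :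
    ∃ n₀ : ℕ, ∀ n ≥ n₀, ∀ h, |Δ_[1] ^[d] (powSeq c n) h| ≤ ε := by
  set C := |∏ j ∈ Finset.range d, (c - j)|
  have h1 : Tendsto (fun n : ℕ => C * (n : ℝ) ^ (-(d - c))) atTop (𝓝 (C * 0)) :=
    ((tendsto_rpow_neg_atTop (sub_pos.2 hd)).comp tendsto_natCast_atTop_atTop).const_mul C
  rw [mul_zero] at h1
  obtain ⟨n₀, h2⟩ := eventually_atTop.1 (h1.eventually (ge_mem_nhds hε))
  refine ⟨max n₀ 1, fun n hn h => ?_⟩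
  have hn1 : 0 < n := by have := le_of_max_le_right hn; omega
  have hn' : (0 : ℝ) < n := by exact_mod_cast hn1
  obtain ⟨ξ, hξ, h3⟩ := exists_fwdDiff_iter_powSeq c hn1 d h
  rw [h3, abs_mul, abs_of_nonneg (Real.rpow_nonneg (by positivity) _)]
  refine le_trans ?_ (h2 n (le_of_max_le_left hn))
  rw [neg_sub]
  exact mul_le_mul_of_nonneg_left
    (Real.rpow_le_rpow_of_nonpos hn' (by linarith) (by linarith)) (abs_nonneg _)

/-- Applying the mean value theorem to the difference gives the same `ξ` in both powers. As `x ↦ x ^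
(c - d)` is nonincreasing, the sign depends only on the constant `C` and on the order of `n` and
`m`. -/
theorem fwdDiff_iter_powSeq_sub_sign (c : ℝ) {d : ℕ} (hd : c ≤ d) {n m : ℕ} (hn : 0 < n)
    (hm : 0 < m) :
    (∀ x, 0 ≤ Δ_[1] ^[d] (powSeq c n - powSeq c m) x) ∨
      ∀ x, Δ_[1] ^[d] (powSeq c n - powSeq c m) x ≤ 0 := by
  set C := ∏ j ∈ Finset.range d, (c - j) with hC
  have hn' : (0 : ℝ) < n := by exact_mod_cast hn
  have hm' : (0 : ℝ) < m := by exact_mod_cast hm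
  have key : ∀ x, ∃ ξ : ℝ, 0 ≤ ξ ∧ Δ_[1] ^[d] (powSeq c n - powSeq c m) x =
      C * ((n + ξ) ^ (c - d) - (m + ξ) ^ (c - d)) := by
    intro x
    obtain ⟨ξ, h1, h2⟩ := exists_fwdDiff_iter_natCast_eq_deriv
      (G := fun i => shiftedPow c n i - shiftedPow c m i)
      (fun i x hx => (hasDerivAt_shiftedPow c hn' i hx).sub (hasDerivAt_shiftedPow c hm' i hx)) d x
    refine ⟨ξ, h1, ?_⟩
    have h3 : powSeq c n - powSeq c m =
        fun k : ℕ => (shiftedPow c n 0 - shiftedPow c m 0) (k : ℝ) := by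
      funext k
      simp [powSeq, shiftedPow]
    rw [h3, h2]
    simp only [Pi.sub_apply, shiftedPow]
    ring
  have mono : ∀ {a b : ℕ}, (0 : ℝ) < a → a ≤ b → ∀ ξ : ℝ, 0 ≤ ξ →
      ((b : ℝ) + ξ) ^ (c - d) ≤ (a + ξ) ^ (c - d) := by
    intro a b ha hab ξ hξ
    exact Real.rpow_le_rpow_of_nonpos (by positivity) (by gcongr) (by linarith)
  rcases le_total n m with h | h <;> rcases le_total 0 C with h' | h'
  · left; intro x
    obtain ⟨ξ, hξ, e⟩ := key x
    rw [e]; exact mul_nonneg h' (by linarith [mono hn' h ξ hξ])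
  · right; intro x
    obtain ⟨ξ, hξ, e⟩ := key x
    rw [e]; exact mul_nonpos_of_nonpos_of_nonneg h' (by linarith [mono hn' h ξ hξ])
  · right; intro x
    obtain ⟨ξ, hξ, e⟩ := key x
    rw [e]; exact mul_nonpos_of_nonneg_of_nonpos h' (by linarith [mono hm' h ξ hξ])
  · left; intro x
    obtain ⟨ξ, hξ, e⟩ := key x
    rw [e]; exact mul_nonneg_of_nonpos_of_nonpos h' (by linarith [mono hm' h ξ hξ])

/-! ### Exponential sums and van der Corput's inequality -/

/-- `expi x = e ^ (2 π i x)`. -/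
noncomputable def expi (x : ℝ) : ℂ := Complex.exp (((2 * Real.pi * x : ℝ) : ℂ) * Complex.I)

theorem expi_add (x y : ℝ) : expi (x + y) = expi x * expi y := by
  rw [expi, expi, expi, ← Complex.exp_add]; congr 1; push_cast; ring

theorem norm_expi (x : ℝ) : ‖expi x‖ = 1 := Complex.norm_exp_ofReal_mul_I _

theorem conj_expi (x : ℝ) : (starRingEnd ℂ) (expi x) = expi (-x) := by
  rw [expi, expi, ← Complex.exp_conj, map_mul, Complex.conj_ofReal, Complex.conj_I]
  congr 1; push_cast; ring

theorem expi_intCast (z : ℤ) : expi z = 1 := by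
  rw [expi, Complex.exp_eq_one_iff]; exact ⟨z, by push_cast; ring⟩

theorem expi_add_intCast (x : ℝ) (z : ℤ) : expi (x + z) = expi x := by
  rw [expi_add, expi_intCast, mul_one]

theorem expi_natCast_mul (n : ℕ) (x : ℝ) : expi (n * x) = expi x ^ n := by
  rw [expi, expi, ← Complex.exp_nat_mul]; congr 1; push_cast; ring

theorem expi_eq_one_iff {x : ℝ} : expi x = 1 ↔ ∃ z : ℤ, x = z := by
  refine ⟨fun h => ?_, fun ⟨z, h⟩ => h ▸ expi_intCast z⟩
  rw [expi, Complex.exp_eq_one_iff] at h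
  obtain ⟨z, h⟩ := h
  refine ⟨z, ?_⟩
  have h1 : ((2 * Real.pi * x : ℝ) : ℂ) = ((2 * Real.pi * z : ℝ) : ℂ) := by
    apply mul_right_cancel₀ Complex.I_ne_zero
    rw [h]; push_cast; ring
  have h2 := Complex.ofReal_injective h1
  exact mul_left_cancel₀ (by positivity : 2 * Real.pi ≠ 0) h2

theorem continuous_expi : Continuous expi := by unfold expi; fun_prop

/-- The correlation form of van der Corput's inequality. -/
theorem norm_sum_mul_le_of_correlations {u : ℕ → ℂ} (hu : ∀ n, ‖u n‖ = 1) {J N : ℕ} {η : ℝ}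
    (hη : 0 ≤ η) (h : ∀ i < J, ∀ j < J, i ≠ j →
      ‖∑ n ∈ Finset.range N, u (n + i) * (starRingEnd ℂ) (u (n + j))‖ ≤ η * N) :
    J * ‖∑ n ∈ Finset.range N, u n‖ ≤ N * Real.sqrt (J + J ^ 2 * η) + 2 * J ^ 2 := by
  have hshift : ∀ i, ‖∑ n ∈ Finset.range N, u n - ∑ n ∈ Finset.range N, u (n + i)‖ ≤ 2 * i := by
    intro i
    have e1 : ∑ n ∈ Finset.range N, u n - ∑ n ∈ Finset.range N, u (n + i) =
        ∑ n ∈ Finset.range i, u n - ∑ n ∈ Finset.range i, u (N + n) := by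
      have h1 := Finset.sum_range_add u N i
      have h2 := Finset.sum_range_add u i N
      rw [add_comm i N, h1] at h2
      simp only [add_comm i] at h2
      rw [sub_eq_sub_iff_add_eq_add]
      exact h2
    have hb : ∀ v : ℕ → ℂ, (∀ n, ‖v n‖ = 1) → ‖∑ n ∈ Finset.range i, v n‖ ≤ i := by
      intro v hv
      refine (norm_sum_le _ _).trans ?_
      simp [hv]
    rw [e1]
    refine (norm_sub_le _ _).trans ?_
    linarith [hb u hu, hb (fun n => u (N + n)) (fun n => hu _)]
  -- Average over `J` shifts, each changing the sum by a boundary term only; then apply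
  -- Cauchy–Schwarz and expand the square into correlations.
  set v : ℕ → ℂ := fun n => ∑ i ∈ Finset.range J, u (n + i) with hv
  have h1 : J * ‖∑ n ∈ Finset.range N, u n‖ ≤ ‖∑ n ∈ Finset.range N, v n‖ + 2 * J ^ 2 := by
    have e1 : (J : ℂ) * ∑ n ∈ Finset.range N, u n = ∑ n ∈ Finset.range N, v n +
        ∑ i ∈ Finset.range J,
          (∑ n ∈ Finset.range N, u n - ∑ n ∈ Finset.range N, u (n + i)) := by
      rw [Finset.sum_sub_distrib, Finset.sum_comm, Finset.sum_const, Finset.card_range,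
        nsmul_eq_mul]
      ring
    have e2 : (J : ℝ) * ‖∑ n ∈ Finset.range N, u n‖ = ‖(J : ℂ) * ∑ n ∈ Finset.range N, u n‖ := by
      simp
    rw [e2, e1]
    refine (norm_add_le _ _).trans (add_le_add le_rfl ?_)
    refine (norm_sum_le _ _).trans ?_
    calc _ ≤ ∑ i ∈ Finset.range J, (2 * J : ℝ) := by
          refine Finset.sum_le_sum fun i hi => (hshift i).trans ?_
          have : (i : ℝ) ≤ J := by exact_mod_cast (Finset.mem_range.1 hi).le
          linarith
      _ = _ := by simp; ring
  have h2 : ∑ n ∈ Finset.range N, ‖v n‖ ^ 2 ≤ N * (J + J ^ 2 * η) := by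
    have e1 : ((∑ n ∈ Finset.range N, ‖v n‖ ^ 2 : ℝ) : ℂ) =
        ∑ i ∈ Finset.range J, ∑ j ∈ Finset.range J, ∑ n ∈ Finset.range N,
          u (n + i) * (starRingEnd ℂ) (u (n + j)) := by
      push_cast
      simp_rw [← Complex.mul_conj', hv, map_sum, Finset.sum_mul_sum]
      rw [Finset.sum_comm]
      refine Finset.sum_congr rfl fun i _ => ?_
      rw [Finset.sum_comm]
    have e2 : ∑ n ∈ Finset.range N, ‖v n‖ ^ 2 = ‖((∑ n ∈ Finset.range N, ‖v n‖ ^ 2 : ℝ) : ℂ)‖ := by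
      rw [Complex.norm_real, Real.norm_of_nonneg (Finset.sum_nonneg fun _ _ => sq_nonneg _)]
    rw [e2, e1]
    calc _ ≤ ∑ i ∈ Finset.range J, ∑ j ∈ Finset.range J, ((if i = j then (N : ℝ) else 0) + η * N) := by
          refine (norm_sum_le _ _).trans (Finset.sum_le_sum fun i hi => ?_)
          refine (norm_sum_le _ _).trans (Finset.sum_le_sum fun j hj => ?_)
          have hN : 0 ≤ η * N := by positivity
          split_ifs with hij
          · refine (norm_sum_le _ _).trans ?_
            simp [hu]
            exact hN
          · rw [zero_add]
            exact h i (Finset.mem_range.1 hi) j (Finset.mem_range.1 hj) hij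
      _ = _ := by
          simp only [Finset.sum_add_distrib, Finset.sum_ite_eq, Finset.sum_const, Finset.card_range,
            nsmul_eq_mul]
          rw [Finset.sum_congr rfl fun i hi => if_pos hi]
          simp
          ring
  have h3 : ‖∑ n ∈ Finset.range N, v n‖ ≤ N * Real.sqrt (J + J ^ 2 * η) := by
    have h4 : ‖∑ n ∈ Finset.range N, v n‖ ^ 2 ≤ N * (N * (J + J ^ 2 * η)) := by
      calc ‖∑ n ∈ Finset.range N, v n‖ ^ 2 ≤ (∑ n ∈ Finset.range N, ‖v n‖) ^ 2 := by
            gcongr; exact norm_sum_le _ _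
        _ ≤ N * ∑ n ∈ Finset.range N, ‖v n‖ ^ 2 := by
            simpa using sq_sum_le_card_mul_sum_sq (s := Finset.range N) (f := fun n => ‖v n‖)
        _ ≤ _ := by gcongr
    have h5 := Real.le_sqrt_of_sq_le h4
    refine h5.trans (le_of_eq ?_)
    rw [← mul_assoc, ← sq, Real.sqrt_mul (by positivity), Real.sqrt_sq (by positivity)]
  linarith

theorem eventually_norm_sum_le_of_correlations {u : ℕ → ℂ} (hu : ∀ n, ‖u n‖ = 1) {J : ℕ} {ε : ℝ}
    (hε : 0 < ε) (hJ : 8 ≤ J * ε ^ 2) (h : ∀ i < J, ∀ j < J, i ≠ j → ∀ᶠ N : ℕ in atTop,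
      ‖∑ n ∈ Finset.range N, u (n + i) * (starRingEnd ℂ) (u (n + j))‖ ≤ ε ^ 2 / 8 * N) :
    ∀ᶠ N : ℕ in atTop, ‖∑ n ∈ Finset.range N, u n‖ ≤ ε * N := by
  have h' : ∀ᶠ N : ℕ in atTop, ∀ i < J, ∀ j < J, i ≠ j →
      ‖∑ n ∈ Finset.range N, u (n + i) * (starRingEnd ℂ) (u (n + j))‖ ≤ ε ^ 2 / 8 * N := by
    have := (Filter.eventually_all_finset (l := atTop) (Finset.range J ×ˢ Finset.range J)
      (p := fun x N => x.1 ≠ x.2 →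
        ‖∑ n ∈ Finset.range N, u (n + x.1) * (starRingEnd ℂ) (u (n + x.2))‖ ≤ ε ^ 2 / 8 * N)).2 (by
      rintro ⟨i, j⟩ hij
      simp only [Finset.mem_product, Finset.mem_range] at hij
      by_cases hne : i = j
      · simp [hne]
      · exact (h i hij.1 j hij.2 hne).mono fun _ h _ => h)
    filter_upwards [this] with N hN i hi j hj hij
    exact hN (i, j) (by simp [hi, hj]) hij
  have hJ0 : (0 : ℝ) < J := by
    by_contra! hc
    nlinarith [sq_nonneg ε]
  have hlarge : ∀ᶠ N : ℕ in atTop, 4 * J / ε ≤ (N : ℝ) :=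
    tendsto_natCast_atTop_atTop.eventually_ge_atTop _
  filter_upwards [h', hlarge] with N hN hlarge
  have h1 := norm_sum_mul_le_of_correlations hu (by positivity) hN
  -- As `8 ≤ J * ε ^ 2`, both terms under the root are at most `J ^ 2 * ε ^ 2 / 8`. The boundary
  -- term `2 * J ^ 2` takes the other half of `ε`.
  have h2 : Real.sqrt (J + J ^ 2 * (ε ^ 2 / 8)) ≤ J * (ε / 2) := by
    rw [Real.sqrt_le_left (by positivity)]
    nlinarith
  rw [div_le_iff₀ hε] at hlarge
  have h3 : (N : ℝ) * Real.sqrt (J + J ^ 2 * (ε ^ 2 / 8)) ≤ N * (J * (ε / 2)) := by gcongr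
  have h4 : J * ‖∑ n ∈ Finset.range N, u n‖ ≤ J * (ε * N) := by nlinarith
  exact le_of_mul_le_mul_left h4 hJ0

theorem sum_range_mul_eq {M : Type*} [AddCommMonoid M] (u : ℕ → M) (q m : ℕ) :
    ∑ n ∈ Finset.range (q * m), u n =
      ∑ r ∈ Finset.range q, ∑ i ∈ Finset.range m, u (q * i + r) := by
  induction m with
  | zero => simp
  | succ m ih =>
    simp only [Finset.sum_range_succ, Finset.sum_add_distrib]
    rw [← ih, mul_add, mul_one, Finset.sum_range_add]

theorem eventually_norm_sum_le_of_progressions {u : ℕ → ℂ} (hu : ∀ n, ‖u n‖ = 1) {q : ℕ}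
    (hq : 0 < q) {ε : ℝ} (hε : 0 < ε)
    (h : ∀ r < q, ∀ᶠ N : ℕ in atTop, ‖∑ i ∈ Finset.range N, u (q * i + r)‖ ≤ ε / 2 * N) :
    ∀ᶠ N : ℕ in atTop, ‖∑ n ∈ Finset.range N, u n‖ ≤ ε * N := by
  have h' := (Filter.eventually_all_finset (l := atTop) (Finset.range q) (p := fun r N =>
    ‖∑ i ∈ Finset.range N, u (q * i + r)‖ ≤ ε / 2 * N)).2 (fun r hr => h r (Finset.mem_range.1 hr))
  have hdiv : Tendsto (fun N : ℕ => N / q) atTop atTop := Nat.tendsto_div_const_atTop hq.ne'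
  have hlarge : ∀ᶠ N : ℕ in atTop, 2 * q / ε ≤ (N : ℝ) :=
    tendsto_natCast_atTop_atTop.eventually_ge_atTop _
  filter_upwards [hdiv.eventually h', hlarge] with N hN hlarge
  rw [div_le_iff₀ hε] at hlarge
  have e1 : ∑ n ∈ Finset.range N, u n = ∑ n ∈ Finset.range (q * (N / q)), u n +
      ∑ n ∈ Finset.range (N % q), u (q * (N / q) + n) := by
    rw [← Finset.sum_range_add, Nat.div_add_mod]
  have h1 : ‖∑ n ∈ Finset.range (q * (N / q)), u n‖ ≤ q * (ε / 2 * (N / q : ℕ)) := by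
    rw [sum_range_mul_eq]
    refine (norm_sum_le _ _).trans ((Finset.sum_le_sum hN).trans ?_)
    simp
  have h2 : ‖∑ n ∈ Finset.range (N % q), u (q * (N / q) + n)‖ ≤ q := by
    refine (norm_sum_le _ _).trans ?_
    simp only [hu, Finset.sum_const, Finset.card_range, nsmul_eq_mul, mul_one]
    exact_mod_cast (Nat.mod_lt _ hq).le
  have h3 : (q : ℝ) * (N / q : ℕ) ≤ N := by exact_mod_cast Nat.mul_div_le N q
  rw [e1]
  refine (norm_add_le _ _).trans ?_
  nlinarith

/-! ### Weyl's theorem, uniform in the polynomial -/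

/-- Up to the constant coefficient, `P` has rational coefficients with a common denominator at
most `Q`. -/
def IsRationalUpTo (Q : ℕ) (P : ℝ[X]) : Prop :=
  ∃ q : ℕ, 0 < q ∧ q ≤ Q ∧ ∃ (W : ℤ[X]) (b : ℝ), C (q : ℝ) * P = W.map (Int.castRingHom ℝ) + C b

theorem IsRationalUpTo.mono {Q Q' : ℕ} (h : Q ≤ Q') {P : ℝ[X]} (hP : IsRationalUpTo Q P) :
    IsRationalUpTo Q' P := by
  obtain ⟨q, h1, h2, h3⟩ := hP
  exact ⟨q, h1, h2.trans h, h3⟩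

theorem natDegree_le_of_map_add_C_eq {W : ℤ[X]} {P : ℝ[X]} {n : ℕ} {q b : ℝ}
    (h : C q * P = W.map (Int.castRingHom ℝ) + C b) (hP : P.natDegree ≤ n) : W.natDegree ≤ n := by
  have h1 : W.map (Int.castRingHom ℝ) = C q * P - C b := by rw [h]; ring
  rw [← natDegree_map_eq_of_injective (f := Int.castRingHom ℝ) Int.cast_injective, h1]
  exact (natDegree_sub_C (a := b)).le.trans ((natDegree_C_mul_le _ _).trans hP)

/-- The factor `q ^ n` clears the denominators created by the inverse substitution `(X - r) / q`. -/
theorem exists_int_comp_eq {n q : ℕ} (hq : 0 < q) (r : ℤ) {W : ℤ[X]} (hW : W.natDegree ≤ n) :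
    ∃ W' : ℤ[X], C ((q : ℝ) ^ n) * (W.map (Int.castRingHom ℝ)).comp (C (q : ℝ)⁻¹ * (X - C (r : ℝ)))
      = W'.map (Int.castRingHom ℝ) := by
  refine ⟨∑ i ∈ Finset.range (n + 1), C (W.coeff i * (q : ℤ) ^ (n - i)) * (X - C r) ^ i, ?_⟩
  have hq' : (q : ℝ) ≠ 0 := by positivity
  conv_lhs => rw [W.as_sum_range' (n + 1) (by omega)]
  rw [Polynomial.map_sum, Polynomial.map_sum, Polynomial.sum_comp, Finset.mul_sum]
  refine Finset.sum_congr rfl fun i hi => ?_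
  have hi' : i ≤ n := by simpa [Nat.lt_succ_iff] using hi
  simp only [map_monomial, monomial_comp, Polynomial.map_mul, map_C, Polynomial.map_pow,
    Polynomial.map_sub, map_X]
  simp only [eq_intCast, Int.cast_mul, Int.cast_pow, Int.cast_natCast]
  rw [mul_pow, ← C_pow]
  have : (q : ℝ) ^ n = q ^ (n - i) * q ^ i := by rw [← pow_add, Nat.sub_add_cancel hi']
  rw [← mul_assoc, ← mul_assoc, ← C_mul, ← C_mul, this]
  congr 2
  rw [inv_pow]
  field_simp

/-- Rationality of a polynomial follows from rationality along a progression. -/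
theorem exists_int_of_comp {n q q' : ℕ} (hq : 0 < q) (r : ℕ) {P : ℝ[X]} (hP : P.natDegree ≤ n)
    {W : ℤ[X]} {b : ℝ} (h : C (q' : ℝ) * P.comp (C (q : ℝ) * X + C (r : ℝ)) =
      W.map (Int.castRingHom ℝ) + C b) :
    ∃ (W' : ℤ[X]) (b' : ℝ),
      C ((q ^ n * q' : ℕ) : ℝ) * P = W'.map (Int.castRingHom ℝ) + C b' := by
  have hq' : (q : ℝ) ≠ 0 := by positivity
  have hdeg : (P.comp (C (q : ℝ) * X + C (r : ℝ))).natDegree ≤ n := by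
    refine natDegree_comp_le.trans ?_
    calc _ ≤ P.natDegree * 1 := Nat.mul_le_mul_left _ (natDegree_linear_le)
      _ ≤ n := by simpa using hP
  obtain ⟨W', hW'⟩ := exists_int_comp_eq hq (r : ℤ) (natDegree_le_of_map_add_C_eq h hdeg)
  refine ⟨W', q ^ n * b, ?_⟩
  have h1 := congrArg (fun S : ℝ[X] => S.comp (C (q : ℝ)⁻¹ * (X - C ((r : ℤ) : ℝ)))) h
  simp only [mul_comp, C_comp, add_comp, comp_assoc, X_comp] at h1
  have h2 : C (q : ℝ) * (C (q : ℝ)⁻¹ * (X - C ((r : ℤ) : ℝ))) + C (r : ℝ) = X := by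
    rw [← mul_assoc, ← C_mul, mul_inv_cancel₀ hq']
    simp
  rw [h2, comp_X] at h1
  rw [Nat.cast_mul, C_mul, mul_assoc, h1, mul_add, Nat.cast_pow, hW', ← C_mul]

theorem eventually_norm_sum_expi_linear {α β ε : ℝ} (hα : ∀ z : ℤ, α ≠ z) (hε : 0 < ε) :
    ∀ᶠ N : ℕ in atTop, ‖∑ n ∈ Finset.range N, expi (α * n + β)‖ ≤ ε * N := by
  have hne : expi α ≠ 1 := fun h => by
    obtain ⟨z, hz⟩ := expi_eq_one_iff.1 h
    exact hα z hz
  have hpos : 0 < ‖expi α - 1‖ := norm_pos_iff.2 (sub_ne_zero.2 hne)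
  have hlarge : ∀ᶠ N : ℕ in atTop, 2 / ‖expi α - 1‖ / ε ≤ (N : ℝ) :=
    tendsto_natCast_atTop_atTop.eventually_ge_atTop _
  filter_upwards [hlarge] with N hN
  have e1 : ∀ n : ℕ, expi (α * n + β) = expi α ^ n * expi β := by
    intro n
    rw [expi_add, mul_comm α, expi_natCast_mul]
  simp_rw [e1]
  rw [← Finset.sum_mul, geom_sum_eq hne, norm_mul, norm_expi, mul_one, norm_div]
  rw [div_le_iff₀ hε] at hN
  rw [mul_comm]
  refine le_trans ?_ hN
  gcongr
  refine (norm_sub_le _ _).trans ?_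
  rw [norm_pow, norm_expi]
  norm_num

theorem hasseDeriv_eval_of_natDegree_le {P : ℝ[X]} {n : ℕ} (hP : P.natDegree ≤ n + 1) (r : ℝ) :
    (hasseDeriv n P).eval r = P.coeff n + (n + 1) * P.coeff (n + 1) * r := by
  have h1 : (hasseDeriv n P).natDegree < 2 := by
    have := natDegree_hasseDeriv_le P n
    omega
  rw [eval_eq_sum_range' h1]
  simp [Finset.sum_range_succ, hasseDeriv_coeff, Nat.choose_succ_self_right, add_comm 1 n]

/-- The difference of two translates of a polynomial has smaller degree. -/
theorem natDegree_taylor_sub_le {P : ℝ[X]} {n : ℕ} (hP : P.natDegree ≤ n + 1) (r s : ℝ) :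
    (taylor r P - taylor s P).natDegree ≤ n := by
  rw [natDegree_le_iff_coeff_eq_zero]
  intro m hm
  have h1 : ∀ r, (taylor r P).coeff m = P.coeff m := by
    intro r
    rw [taylor_coeff]
    have h2 : (hasseDeriv m P).natDegree < 1 := by
      have := natDegree_hasseDeriv_le P m
      omega
    rw [eval_eq_sum_range' h2]
    simp [hasseDeriv_coeff]
  rw [coeff_sub, h1, h1, sub_self]

theorem coeff_taylor_sub {P : ℝ[X]} {n : ℕ} (hP : P.natDegree ≤ n + 1) (r s : ℝ) :
    (taylor r P - taylor s P).coeff n = (n + 1) * P.coeff (n + 1) * (r - s) := by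
  rw [coeff_sub, taylor_coeff, taylor_coeff, hasseDeriv_eval_of_natDegree_le hP,
    hasseDeriv_eval_of_natDegree_le hP]
  ring

/-- If the leading coefficient of `P` is rational, the problem for `P` reduces to smaller degree. -/
theorem weyl_of_rational_leadingCoeff {n Q q : ℕ} {ε : ℝ} (hε : 0 < ε) (hq : 0 < q)
    (hQ : ∀ P : ℝ[X], P.natDegree ≤ n → IsRationalUpTo Q P ∨
      ∀ᶠ N : ℕ in atTop, ‖∑ i ∈ Finset.range N, expi (P.eval (i : ℝ))‖ ≤ ε / 2 * N)
    {P : ℝ[X]} (hP : P.natDegree ≤ n + 1) {z : ℤ} (hz : q * P.coeff (n + 1) = z) (hn : 0 < n) :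
    IsRationalUpTo (q ^ n * Q) P ∨
      ∀ᶠ N : ℕ in atTop, ‖∑ i ∈ Finset.range N, expi (P.eval (i : ℝ))‖ ≤ ε * N := by
  set α := P.coeff (n + 1) with hα
  set P' := P - C α * X ^ (n + 1) with hP'
  have hPP' : P = P' + C α * X ^ (n + 1) := by rw [hP']; ring
  have hdeg : P'.natDegree ≤ n := by
    rw [natDegree_le_iff_coeff_eq_zero]
    intro m hm
    rw [hP', coeff_sub, coeff_C_mul_X_pow]
    split_ifs with h
    · rw [h, hα, sub_self]
    · rw [coeff_eq_zero_of_natDegree_lt (by omega), sub_zero]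
  by_cases hall : ∀ r < q, ∀ᶠ N : ℕ in atTop, ‖∑ i ∈ Finset.range N,
      expi ((P'.comp (C (q : ℝ) * X + C (r : ℝ))).eval (i : ℝ))‖ ≤ ε / 2 * N
  · right
    refine eventually_norm_sum_le_of_progressions (fun n => norm_expi _) hq hε fun r hr => ?_
    filter_upwards [hall r hr] with N hN
    refine le_trans (le_of_eq ?_) hN
    -- Since `q * α` is an integer, `α * x ^ (n + 1)` is constant modulo 1 along `x = q * i + r`, so
    -- only the lower-degree part `P'` matters.
    have e1 : ∀ i : ℕ, expi (P.eval ((q * i + r : ℕ) : ℝ)) =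
        expi ((P'.comp (C (q : ℝ) * X + C (r : ℝ))).eval (i : ℝ)) * expi (α * r ^ (n + 1)) := by
      intro i
      obtain ⟨w, hw⟩ : ∃ w : ℤ, ((q : ℝ) * i + r) ^ (n + 1) = r ^ (n + 1) + q * w := by
        have : (q : ℤ) ∣ ((q : ℤ) * i + r) ^ (n + 1) - r ^ (n + 1) := by
          refine dvd_trans ?_ (sub_dvd_pow_sub_pow _ _ _)
          simp
        obtain ⟨w, hw⟩ := this
        refine ⟨w, ?_⟩
        have h2 : (((q : ℤ) * i + r : ℤ) : ℝ) ^ (n + 1) - (r : ℝ) ^ (n + 1) = q * w := by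
          exact_mod_cast hw
        push_cast at h2
        linarith
      rw [← expi_add, ← expi_add_intCast (P.eval _) (-(z * w))]
      congr 1
      rw [hPP']
      simp only [eval_add, eval_mul, eval_C, eval_pow, eval_X, eval_comp]
      push_cast
      rw [hw, ← hz]
      ring
    simp_rw [e1]
    rw [← Finset.sum_mul, norm_mul, norm_expi, mul_one]
  · left
    simp only [not_forall] at hall
    obtain ⟨r, -, hr⟩ := hall
    have hdeg' : (P'.comp (C (q : ℝ) * X + C (r : ℝ))).natDegree ≤ n := by
      refine natDegree_comp_le.trans ?_
      calc _ ≤ P'.natDegree * 1 := Nat.mul_le_mul_left _ (natDegree_linear_le)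
        _ ≤ n := by simpa using hdeg
    rcases hQ _ hdeg' with ⟨q', hq', hq'Q, W, b, hW⟩ | h
    · obtain ⟨W', b', hW'⟩ := exists_int_of_comp hq r hdeg hW
      -- Because `n > 0`, the denominator `q ^ n * q'` found for `P'` contains the factor `q` that
      -- clears the leading coefficient as well.
      refine ⟨q ^ n * q', Nat.mul_pos (pow_pos hq _) hq', Nat.mul_le_mul_left _ hq'Q,
        W' + C ((q : ℤ) ^ (n - 1) * q' * z) * X ^ (n + 1), b', ?_⟩
      have e1 : (Int.castRingHom ℝ) ((q : ℤ) ^ (n - 1) * q' * z) = (q : ℝ) ^ (n - 1) * q' * z := by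
        simp
      rw [hPP', mul_add, hW', Polynomial.map_add, Polynomial.map_mul, map_C, Polynomial.map_pow,
        map_X, e1, ← hz, ← mul_assoc, ← C_mul]
      have e2 : ((q ^ n * q' : ℕ) : ℝ) * α = (q : ℝ) ^ (n - 1) * q' * (q * α) := by
        obtain ⟨m, rfl⟩ : ∃ m, n = m + 1 := ⟨n - 1, by omega⟩
        push_cast
        ring
      rw [e2]
      ring
    · exact absurd h hr

/-- **Weyl's theorem**, uniformly: the mean value of `expi (P n)` is small for every real
polynomial `P` of bounded degree, unless `P` is rational with bounded denominator. -/
theorem weyl_dichotomy (d : ℕ) {ε : ℝ} (hε : 0 < ε) :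
    ∃ Q : ℕ, 0 < Q ∧ ∀ P : ℝ[X], P.natDegree ≤ d + 1 → IsRationalUpTo Q P ∨
      ∀ᶠ N : ℕ in atTop, ‖∑ n ∈ Finset.range N, expi (P.eval (n : ℝ))‖ ≤ ε * N := by
  induction d generalizing ε with
  | zero =>
    refine ⟨1, one_pos, fun P hP => ?_⟩
    rw [zero_add] at hP
    have hP' := eq_X_add_C_of_natDegree_le_one hP
    by_cases h : ∃ z : ℤ, P.coeff 1 = z
    · obtain ⟨z, hz⟩ := h
      left
      refine ⟨1, one_pos, le_rfl, C z * X, P.coeff 0, ?_⟩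
      rw [hP', hz]
      simp
    · push Not at h
      right
      have := eventually_norm_sum_expi_linear (β := P.coeff 0) h hε
      have e1 : ∀ n : ℕ, P.eval (n : ℝ) = P.coeff 1 * n + P.coeff 0 := by
        intro n
        conv_lhs => rw [hP']
        simp
      simpa only [e1] using this
  | succ d ih =>
    obtain ⟨Q₁, hQ₁0, hQ₁⟩ := ih (ε := ε ^ 2 / 8) (by positivity)
    obtain ⟨Q₂, hQ₂0, hQ₂⟩ := ih (ε := ε / 2) (by positivity)
    obtain ⟨J, hJ⟩ := exists_nat_ge (8 / ε ^ 2)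
    rw [div_le_iff₀ (by positivity)] at hJ
    have hJ0 : 0 < J := by
      rcases Nat.eq_zero_or_pos J with rfl | h
      · norm_num at hJ
      · exact h
    -- If a correlation of shifts `i ≠ j` is large, the differenced polynomial is rational; its
    -- coefficient of degree `d + 1` is `(d + 2) * (i - j)` times that of `P` in degree `d + 2`.
    -- This gives the latter a denominator at most `Q₁ * ((d + 2) * J)`; `Q₂` handles the remaining
    -- coefficients.
    refine ⟨(Q₁ * ((d + 2) * J)) ^ (d + 1) * Q₂, by positivity, fun P hP => ?_⟩
    by_cases hall : ∀ i < J, ∀ j < J, i ≠ j → ∀ᶠ N : ℕ in atTop, ‖∑ n ∈ Finset.range N,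
        expi ((taylor (i : ℝ) P - taylor (j : ℝ) P).eval (n : ℝ))‖ ≤ ε ^ 2 / 8 * N
    · right
      refine eventually_norm_sum_le_of_correlations (fun n => norm_expi _) hε hJ
        fun i hi j hj hij => ?_
      refine (hall i hi j hj hij).mono fun N hN => le_trans (le_of_eq ?_) hN
      congr 1
      refine Finset.sum_congr rfl fun n _ => ?_
      rw [conj_expi, ← expi_add]
      congr 1
      simp only [eval_sub, taylor_eval]
      push_cast
      ring
    · simp only [not_forall] at hall
      obtain ⟨i, hi, j, hj, hij, hN⟩ := hall
      have hdeg := natDegree_taylor_sub_le hP (i : ℝ) j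
      rcases hQ₁ _ hdeg with ⟨q', hq', hq'Q, W, b, hW⟩ | h
      · have hc := congrArg (fun S => S.coeff (d + 1)) hW
        simp only [coeff_C_mul, coeff_add, coeff_map, eq_intCast, coeff_C_succ, add_zero] at hc
        rw [coeff_taylor_sub hP] at hc
        set q := q' * ((d + 2) * ((i : ℤ) - j).natAbs) with hq
        have habs : 0 < ((i : ℤ) - j).natAbs := by omega
        have habs' : ((i : ℤ) - j).natAbs ≤ J := by omega
        have hqpos : 0 < q := by positivity
        have hqle : q ≤ Q₁ * ((d + 2) * J) :=
          Nat.mul_le_mul hq'Q (Nat.mul_le_mul_left _ habs')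
        obtain ⟨z, hz⟩ : ∃ z : ℤ, (q : ℝ) * P.coeff (d + 1 + 1) = z := by
          have e1 : (((i : ℤ) - j).natAbs : ℝ) = |(i : ℝ) - j| := by
            rw [Nat.cast_natAbs]; push_cast; rfl
          rw [hq]
          push_cast at hc ⊢
          rw [e1]
          rcases abs_choice ((i : ℝ) - j) with h | h
          · exact ⟨W.coeff (d + 1), by rw [h, ← hc]; ring⟩
          · exact ⟨-W.coeff (d + 1), by rw [h]; push_cast; rw [← hc]; ring⟩
        refine (weyl_of_rational_leadingCoeff hε hqpos hQ₂ hP hz (Nat.succ_pos _)).imp_left ?_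
        exact IsRationalUpTo.mono (Nat.mul_le_mul_right _ (Nat.pow_le_pow_left hqle _))
      · exact absurd h hN

/-! ### From exponential sums to rare visits -/

theorem norm_sum_expi_neg (x : ℕ → ℝ) (ℓ : ℕ) :
    ‖∑ h ∈ Finset.range ℓ, expi (-x h)‖ = ‖∑ h ∈ Finset.range ℓ, expi (x h)‖ := by
  rw [← RCLike.norm_conj (∑ h ∈ Finset.range ℓ, expi (x h)), map_sum]
  simp_rw [conj_expi]

theorem norm_sum_expi_sub_mul_le {K ℓ : ℕ} {x : ℕ → ℝ}
    (hx : ∀ t : ℕ, 0 < t → t < K → ‖∑ h ∈ Finset.range ℓ, expi (t * x h)‖ ≤ ℓ / K)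
    {i j : ℕ} (hi : i < K) (hj : j < K) (hij : i ≠ j) (y : ℝ) :
    ‖∑ h ∈ Finset.range ℓ, expi (i * (x h - y)) * (starRingEnd ℂ) (expi (j * (x h - y)))‖ ≤
      ℓ / K := by
  have e1 : ∀ h, expi (i * (x h - y)) * (starRingEnd ℂ) (expi (j * (x h - y))) =
      expi (((i : ℝ) - j) * x h) * expi (-((i : ℝ) - j) * y) := by
    intro h
    rw [conj_expi, ← expi_add, ← expi_add]
    congr 1
    ring
  simp_rw [e1]
  rw [← Finset.sum_mul, norm_mul, norm_expi, mul_one]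
  rcases lt_or_gt_of_ne hij with h | h
  · rw [← norm_sum_expi_neg]
    have := hx (j - i) (by omega) (by omega)
    rw [Nat.cast_sub h.le] at this
    convert this using 6
    ring
  · have := hx (i - j) (by omega) (by omega)
    rwa [Nat.cast_sub h.le] at this

/-- Expand the square: the diagonal contributes `J * ℓ`, and off-diagonal terms are sums at
frequencies `|i - j| < K`. The translation by `y` is only a unimodular factor, so the bound is
uniform in `y`. -/
theorem sum_sq_norm_sum_expi_le {K ℓ J : ℕ} {x : ℕ → ℝ}
    (hx : ∀ t : ℕ, 0 < t → t < K → ‖∑ h ∈ Finset.range ℓ, expi (t * x h)‖ ≤ ℓ / K)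
    (hJ : J ≤ K) (y : ℝ) :
    ∑ h ∈ Finset.range ℓ, ‖∑ j ∈ Finset.range J, expi (j * (x h - y))‖ ^ 2 ≤
      J * ℓ + J ^ 2 * (ℓ / K) := by
  have e1 : ((∑ h ∈ Finset.range ℓ, ‖∑ j ∈ Finset.range J, expi (j * (x h - y))‖ ^ 2 : ℝ) : ℂ) =
      ∑ i ∈ Finset.range J, ∑ j ∈ Finset.range J, ∑ h ∈ Finset.range ℓ,
        expi (i * (x h - y)) * (starRingEnd ℂ) (expi (j * (x h - y))) := by
    push_cast
    simp_rw [← Complex.mul_conj', map_sum, Finset.sum_mul_sum]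
    rw [Finset.sum_comm]
    refine Finset.sum_congr rfl fun i _ => ?_
    rw [Finset.sum_comm]
  rw [← Real.norm_of_nonneg (Finset.sum_nonneg fun _ _ => sq_nonneg _ : (0 : ℝ) ≤
    ∑ h ∈ Finset.range ℓ, ‖∑ j ∈ Finset.range J, expi (j * (x h - y))‖ ^ 2), ← Complex.norm_real, e1]
  calc _ ≤ ∑ i ∈ Finset.range J, ∑ j ∈ Finset.range J,
        ((if i = j then (ℓ : ℝ) else 0) + ℓ / K) := by
        refine (norm_sum_le _ _).trans (Finset.sum_le_sum fun i hi => ?_)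
        refine (norm_sum_le _ _).trans (Finset.sum_le_sum fun j hj => ?_)
        have hN : 0 ≤ (ℓ : ℝ) / K := by positivity
        rw [Finset.mem_range] at hi hj
        split_ifs with hij
        · refine (norm_sum_le _ _).trans ?_
          simp [norm_expi]
          exact hN
        · rw [zero_add]
          exact norm_sum_expi_sub_mul_le hx (by omega) (by omega) hij y
    _ = _ := by
        simp only [Finset.sum_add_distrib, Finset.sum_ite_eq, Finset.sum_const, Finset.card_range,
          nsmul_eq_mul]
        rw [Finset.sum_congr rfl fun i hi => if_pos hi]
        simp
        ring

/-- All phases lie in `[0, π / 3]` modulo `2 π`, so every real part is at least `1 / 2`. -/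
theorem half_le_norm_sum_expi {J : ℕ} {x y : ℝ} (z : ℤ) (h0 : 0 ≤ x - z - y)
    (h1 : 6 * J * (x - z - y) ≤ 1) :
    (J : ℝ) / 2 ≤ ‖∑ j ∈ Finset.range J, expi (j * (x - y))‖ := by
  refine le_trans ?_ (Complex.re_le_norm _)
  rw [Complex.re_sum]
  calc (J : ℝ) / 2 = ∑ j ∈ Finset.range J, (1 / 2 : ℝ) := by simp; ring
    _ ≤ _ := by
      refine Finset.sum_le_sum fun j hj => ?_
      have hj' : (j : ℝ) ≤ J := by exact_mod_cast (Finset.mem_range.1 hj).le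
      have e1 : expi (j * (x - y)) = expi (j * (x - z - y)) := by
        rw [← expi_add_intCast (j * (x - z - y)) (j * z)]
        congr 1
        push_cast
        ring
      rw [e1, expi, Complex.exp_ofReal_mul_I_re, ← Real.cos_pi_div_three]
      have hle : (j : ℝ) * (x - z - y) ≤ J * (x - z - y) := by gcongr
      apply Real.cos_le_cos_of_nonneg_of_le_pi
      · have := Real.pi_pos
        positivity
      · linarith [Real.pi_pos]
      · nlinarith [Real.pi_pos]

/-- A one-sided quantitative equidistribution estimate: if the exponential sums of `x` are small,
then `x` rarely visits a small union of intervals `[r / K, (r + 1) / K)`. -/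
theorem card_filter_floor_fract_le {K ℓ : ℕ} (hK : 6 ≤ K) (B : Finset ℕ) {x : ℕ → ℝ}
    (hx : ∀ t : ℕ, 0 < t → t < K → ‖∑ h ∈ Finset.range ℓ, expi (t * x h)‖ ≤ ℓ / K) :
    (((Finset.range ℓ).filter fun h => ⌊K * Int.fract (x h)⌋₊ ∈ B).card : ℝ) ≤
      52 * (B.card / K) * ℓ := by
  have hK0 : (0 : ℝ) < K := by exact_mod_cast (by omega : 0 < K)
  -- The largest length for which an interval of length `1 / K` keeps all phases below `π / 3`; it
  -- is positive as `K ≥ 6`.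
  set J := K / 6 with hJ
  have hJ0 : (0 : ℝ) < J := by exact_mod_cast (by omega : 0 < J)
  have hKJ : (K : ℝ) ≤ 12 * J := by exact_mod_cast (by omega : K ≤ 12 * J)
  have hJK : 6 * (J : ℝ) ≤ K := by exact_mod_cast (by omega : 6 * J ≤ K)
  -- A sum of Fejér-type kernels majorizes the indicator function of the intervals.
  have h1 : ∀ h, (if ⌊K * Int.fract (x h)⌋₊ ∈ B then (1 : ℝ) else 0) ≤
      ∑ r ∈ B, 4 / (J : ℝ) ^ 2 * ‖∑ j ∈ Finset.range J, expi (j * (x h - r / K))‖ ^ 2 := by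
    intro h
    split_ifs with hB
    · refine le_trans ?_ (Finset.single_le_sum (fun r _ => by positivity) hB)
      set r := ⌊K * Int.fract (x h)⌋₊
      have hr1 : (r : ℝ) ≤ K * Int.fract (x h) :=
        Nat.floor_le (mul_nonneg hK0.le (Int.fract_nonneg _))
      have hr2 : K * Int.fract (x h) < r + 1 := Nat.lt_floor_add_one _
      have hy : K * (x h - ⌊x h⌋ - r / K) = K * Int.fract (x h) - r := by
        rw [mul_sub, mul_div_cancel₀ _ hK0.ne', Int.self_sub_floor]
      have hy0 : 0 ≤ x h - ⌊x h⌋ - r / K := by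
        by_contra! hc
        nlinarith
      have := half_le_norm_sum_expi (J := J) ⌊x h⌋ hy0 (by nlinarith)
      have h2 : ((J : ℝ) / 2) ^ 2 ≤ ‖∑ j ∈ Finset.range J, expi (j * (x h - r / K))‖ ^ 2 := by
        gcongr
      calc (1 : ℝ) = 4 / (J : ℝ) ^ 2 * (J / 2) ^ 2 := by field_simp; norm_num
        _ ≤ _ := by gcongr
    · positivity
  rw [Finset.card_filter]
  push_cast
  calc _ ≤ ∑ h ∈ Finset.range ℓ, ∑ r ∈ B,
        4 / (J : ℝ) ^ 2 * ‖∑ j ∈ Finset.range J, expi (j * (x h - r / K))‖ ^ 2 :=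
        Finset.sum_le_sum fun h _ => h1 h
    _ = ∑ r ∈ B, 4 / (J : ℝ) ^ 2 *
          ∑ h ∈ Finset.range ℓ, ‖∑ j ∈ Finset.range J, expi (j * (x h - r / K))‖ ^ 2 := by
        rw [Finset.sum_comm]
        simp_rw [Finset.mul_sum]
    _ ≤ ∑ r ∈ B, 4 / (J : ℝ) ^ 2 * (J * ℓ + J ^ 2 * (ℓ / K)) := by
        gcongr with r hr
        exact sum_sq_norm_sum_expi_le hx (by omega) _
    _ = B.card * (4 * (ℓ / J) + 4 * (ℓ / K)) := by
        rw [Finset.sum_const, nsmul_eq_mul]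
        field_simp
    -- From `K ≤ 12 * J`; the constant is `52 = 4 * 12 + 4`.
    _ ≤ B.card * (4 * (12 * (ℓ / K)) + 4 * (ℓ / K)) := by
        have : (ℓ : ℝ) / J ≤ 12 * (ℓ / K) := by
          rw [← mul_div_assoc, div_le_div_iff₀ hJ0 hK0]
          nlinarith [Nat.cast_nonneg (α := ℝ) ℓ]
        gcongr
    _ = _ := by ring

/-! ### Small sums or a nearby rational polynomial -/

/-- The polynomial whose value at a natural number `h` is `h.choose j`. -/
noncomputable def binomialPoly (j : ℕ) : ℝ[X] := C ((j.factorial : ℝ)⁻¹) * descPochhammer ℝ j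

theorem eval_binomialPoly (j h : ℕ) : (binomialPoly j).eval (h : ℝ) = h.choose j := by
  rw [binomialPoly, eval_C_mul, descPochhammer_eval_eq_descFactorial,
    Nat.descFactorial_eq_factorial_mul_choose, Nat.cast_mul, inv_mul_cancel_left₀]
  exact_mod_cast j.factorial_ne_zero

theorem natDegree_binomialPoly_le (j : ℕ) : (binomialPoly j).natDegree ≤ j :=
  (natDegree_C_mul_le _ _).trans (descPochhammer_natDegree ℝ j).le

theorem eval_descPochhammer_int (j h : ℕ) :
    (descPochhammer ℤ j).eval (h : ℤ) = j.factorial * h.choose j := by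
  rw [descPochhammer_eval_eq_descFactorial, Nat.descFactorial_eq_factorial_mul_choose]
  push_cast
  rfl

/-- A family of sequences that is asymptotically polynomial has small exponential sums over some
window of bounded length, except for members that are close to a rational polynomial of bounded
denominator. -/
theorem exists_small_sums_or_near_rational (d T : ℕ) {ε : ℝ} (hε : 0 < ε) :
    ∃ Q : ℕ, 0 < Q ∧ ∀ (x : ℕ → ℕ → ℝ) (A : ℕ → ℕ → ℝ),
      (∀ h, Tendsto (fun n => x n h - ∑ j ∈ Finset.range (d + 2), (h.choose j : ℝ) * A n j)
        atTop (𝓝 0)) →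
      ∀ (H₁ : ℕ) (ρ : ℝ), 0 < ρ → ∃ H₂ n₀ : ℕ, ∀ n ≥ n₀,
        (∃ ℓ, H₁ ≤ ℓ ∧ ℓ ≤ H₂ ∧ ∀ t : ℕ, 0 < t → t < T →
          ‖∑ h ∈ Finset.range ℓ, expi (t * x n h)‖ ≤ ε * ℓ) ∨
        ∃ q : ℕ, 0 < q ∧ q ≤ Q ∧ ∃ W : ℤ[X], W.natDegree ≤ d + 1 ∧ ∃ b : ℝ, ∀ h < H₁,
          |q * x n h - (W.eval (h : ℤ) + b)| < ρ := by
  obtain ⟨Q₀, hQ₀, hweyl⟩ := weyl_dichotomy d (half_pos hε)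
  -- The denominator combines Weyl's `Q₀`, the frequency `t < T`, and the factorial turning binomial
  -- coefficients into integer polynomials.
  refine ⟨Q₀ * (T + 1) * (d + 1).factorial, by positivity, fun x A hx H₁ ρ hρ => ?_⟩
  by_contra hcon
  push Not at hcon
  -- Compactness: take a counterexample with `H₂ = n₀ = i` for each `i`. Along a subsequence the
  -- fractional parts of the coefficients converge, the integer parts contribute only integers, and
  -- Weyl's dichotomy for the limit `P` contradicts one of the two failures.
  have hcon' := fun i => hcon i i
  choose n hn hbad₁ hbad₂ using hcon'
  clear hcon
  have hmem : ∀ i, (fun j : Fin (d + 2) => Int.fract (A (n i) j)) ∈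
      Set.Icc (0 : Fin (d + 2) → ℝ) 1 :=
    fun i => ⟨fun j => Int.fract_nonneg _, fun j => (Int.fract_lt_one _).le⟩
  obtain ⟨θ, -, φ, hφ, hθ⟩ := isCompact_Icc.tendsto_subseq hmem
  set P : ℝ[X] := ∑ j : Fin (d + 2), C (θ j) * binomialPoly j with hP
  have hPeval : ∀ h : ℕ, P.eval (h : ℝ) = ∑ j : Fin (d + 2), (h.choose j : ℝ) * θ j := by
    intro h
    rw [hP, eval_finsetSum]
    refine Finset.sum_congr rfl fun j _ => ?_
    rw [eval_C_mul, eval_binomialPoly, mul_comm]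
  have hPdeg : P.natDegree ≤ d + 1 := by
    refine natDegree_sum_le_of_forall_le _ _ fun j _ => ?_
    exact (natDegree_C_mul_le _ _).trans ((natDegree_binomialPoly_le j).trans (by omega))
  have hnφ : Tendsto (fun i => n (φ i)) atTop atTop :=
    tendsto_atTop_mono (fun i => (hφ.id_le i).trans (hn (φ i))) tendsto_id
  let Z : ℕ → ℕ → ℤ := fun i h => ∑ j : Fin (d + 2), (h.choose j : ℤ) * ⌊A (n (φ i)) j⌋
  have hlim : ∀ h : ℕ, Tendsto (fun i => x (n (φ i)) h - Z i h) atTop (𝓝 (P.eval (h : ℝ))) := by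
    intro h
    have h1 := (hx h).comp hnφ
    have h2 : Tendsto (fun i => ∑ j : Fin (d + 2), (h.choose j : ℝ) * Int.fract (A (n (φ i)) j))
        atTop (𝓝 (∑ j : Fin (d + 2), (h.choose j : ℝ) * θ j)) :=
      tendsto_finsetSum _ fun j _ => (tendsto_pi_nhds.1 hθ j).const_mul _
    rw [hPeval]
    have h3 := h1.add h2
    rw [zero_add] at h3
    refine h3.congr fun i => ?_
    simp only [Function.comp, Z, Finset.sum_range, Int.fract, mul_sub, Finset.sum_sub_distrib]
    push_cast
    ring
  by_cases hall : ∀ t ∈ Finset.Ioo 0 T, ∀ᶠ N : ℕ in atTop,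
      ‖∑ h ∈ Finset.range N, expi ((C (t : ℝ) * P).eval (h : ℝ))‖ ≤ ε / 2 * N
  · obtain ⟨ℓ, hℓ, hℓ₁⟩ := (((Filter.eventually_all_finset _).2 hall).and
      (eventually_ge_atTop (max H₁ 1))).exists
    have hℓ0 : (0 : ℝ) < ℓ := by exact_mod_cast (le_max_right _ _).trans hℓ₁
    have hev : ∀ t ∈ Finset.Ioo 0 T, ∀ᶠ i : ℕ in atTop,
        ‖∑ h ∈ Finset.range ℓ, expi (t * x (n (φ i)) h)‖ ≤ ε * ℓ := by
      intro t ht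
      have h1 : Tendsto (fun i => ‖∑ h ∈ Finset.range ℓ, expi (t * (x (n (φ i)) h - Z i h))‖) atTop
          (𝓝 ‖∑ h ∈ Finset.range ℓ, expi ((C (t : ℝ) * P).eval (h : ℝ))‖) := by
        refine (tendsto_finsetSum _ fun h _ => ?_).norm
        rw [eval_C_mul]
        exact (continuous_expi.tendsto _).comp ((hlim h).const_mul _)
      have h2 : ‖∑ h ∈ Finset.range ℓ, expi ((C (t : ℝ) * P).eval (h : ℝ))‖ < ε * ℓ :=
        (hℓ t ht).trans_lt (by nlinarith)
      filter_upwards [h1.eventually (gt_mem_nhds h2)] with i hi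
      refine le_trans (le_of_eq ?_) hi.le
      congr 1
      refine Finset.sum_congr rfl fun h _ => ?_
      rw [← expi_add_intCast (t * (x (n (φ i)) h - Z i h)) (t * Z i h)]
      congr 1
      push_cast
      ring
    obtain ⟨i, hi, hiℓ⟩ := (((Filter.eventually_all_finset _).2 hev).and
      (eventually_ge_atTop ℓ)).exists
    obtain ⟨t, ht0, htT, ht⟩ := hbad₁ (φ i) ℓ ((le_max_left _ _).trans hℓ₁)
      (hiℓ.trans (hφ.id_le i))
    exact absurd (hi t (Finset.mem_Ioo.2 ⟨ht0, htT⟩)) (not_le.2 ht)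
  · simp only [not_forall] at hall
    obtain ⟨t, ht, hN⟩ := hall
    rw [Finset.mem_Ioo] at ht
    have hdeg : (C (t : ℝ) * P).natDegree ≤ d + 1 := (natDegree_C_mul_le _ _).trans hPdeg
    obtain ⟨q, hq0, hqQ, W, b, hW⟩ := (hweyl _ hdeg).resolve_right hN
    have hWdeg := natDegree_le_of_map_add_C_eq hW hdeg
    set F := (d + 1).factorial with hF
    have hWP : ∀ h : ℕ, (q : ℝ) * (t * P.eval (h : ℝ)) = W.eval (h : ℤ) + b := by
      intro h
      have := congrArg (eval (h : ℝ)) hW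
      rw [eval_C_mul, eval_C_mul, eval_add, eval_C] at this
      rw [this, eval_map, ← Int.cast_natCast h, ← eq_intCast (Int.castRingHom ℝ) (h : ℤ),
        eval₂_at_apply]
      simp
    have hev : ∀ h ∈ Finset.range H₁, ∀ᶠ i : ℕ in atTop,
        |(q * t * F : ℕ) * (x (n (φ i)) h - Z i h) - F * (W.eval (h : ℤ) + b)| < ρ := by
      intro h _
      have h1 : Tendsto (fun i => ((q * t * F : ℕ) : ℝ) * (x (n (φ i)) h - Z i h)) atTop
          (𝓝 (F * (W.eval (h : ℤ) + b))) := by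
        rw [← hWP]
        convert (hlim h).const_mul ((q * t * F : ℕ) : ℝ) using 2
        push_cast
        ring
      have := (Metric.tendsto_nhds.1 h1) ρ hρ
      simpa only [Real.dist_eq] using this
    obtain ⟨i, hi⟩ := ((Filter.eventually_all_finset _).2 hev).exists
    obtain ⟨h, hh, hbad⟩ := hbad₂ (φ i) (q * t * F)
      (Nat.mul_pos (Nat.mul_pos hq0 ht.1) (Nat.factorial_pos _))
      (Nat.mul_le_mul_right _ (Nat.mul_le_mul hqQ (by omega)))
      (C (F : ℤ) * W + ∑ j : Fin (d + 2),
        C ((q * t * (F / (j : ℕ).factorial : ℕ) : ℤ) * ⌊A (n (φ i)) j⌋) * descPochhammer ℤ j)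
      (by
        refine natDegree_add_le_of_degree_le ((natDegree_C_mul_le _ _).trans hWdeg) ?_
        refine natDegree_sum_le_of_forall_le _ _ fun j _ => ?_
        refine (natDegree_C_mul_le _ _).trans ((descPochhammer_natDegree ℤ j).le.trans (by omega)))
      (F * b)
    refine absurd (hi h (Finset.mem_range.2 hh)) (not_lt.2 (hbad.trans (le_of_eq ?_)))
    have e1 : (∑ j : Fin (d + 2), C ((q * t * (F / (j : ℕ).factorial : ℕ) : ℤ) *
        ⌊A (n (φ i)) j⌋) * descPochhammer ℤ j).eval (h : ℤ) = q * t * F * Z i h := by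
      rw [eval_finsetSum, Finset.mul_sum]
      refine Finset.sum_congr rfl fun j _ => ?_
      rw [eval_C_mul, eval_descPochhammer_int]
      have h2 : ((F / (j : ℕ).factorial : ℕ) : ℤ) * ((j : ℕ).factorial : ℤ) = F := by
        exact_mod_cast Nat.div_mul_cancel (Nat.factorial_dvd_factorial (by omega))
      linear_combination (q : ℤ) * t * ⌊A (n (φ i)) j⌋ * (h.choose j : ℤ) * h2
    congr 1
    rw [eval_add, eval_C_mul, e1]
    push_cast
    ring

/-! ### State words along integer polynomials -/

/-- Words that are determined by a pattern, up to the few positions where the pattern is bad. -/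
theorem exists_card_words_of_patterns_le {τ : Type*} [Fintype τ] [Nonempty τ] {ℓ : ℕ}
    (patterns : Finset (Fin ℓ → ℕ)) (F : ℕ → τ) (bad : ℕ → Prop) [DecidablePred bad] (b : ℕ) :
    ∃ S : Finset (Fin ℓ → τ), S.card ≤ patterns.card * Fintype.card τ ^ b ∧
      ∀ p ∈ patterns, (Finset.univ.filter fun h => bad (p h)).card ≤ b →
        ∀ u : Fin ℓ → τ, (∀ h, ¬ bad (p h) → u h = F (p h)) → u ∈ S := by
  classical
  refine ⟨(patterns.filter fun p => (Finset.univ.filter fun h => bad (p h)).card ≤ b).biUnion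
    fun p => Fintype.piFinset fun h => if bad (p h) then Finset.univ else {F (p h)}, ?_, ?_⟩
  · refine (Finset.card_biUnion_le_card_mul _ _ (Fintype.card τ ^ b) fun p hp => ?_).trans
      (Nat.mul_le_mul_right _ (Finset.card_filter_le _ _))
    rw [Fintype.card_piFinset]
    have e1 : ∀ h, (if bad (p h) then (Finset.univ : Finset τ) else {F (p h)}).card =
        if bad (p h) then Fintype.card τ else 1 := by
      intro h
      split_ifs <;> simp
    simp_rw [e1]
    rw [Finset.prod_ite]
    simp only [Finset.prod_const, one_pow, mul_one]
    exact Nat.pow_le_pow_right Fintype.card_pos (Finset.mem_filter.1 hp).2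
  · intro p hp hb u hu
    rw [Finset.mem_biUnion]
    refine ⟨p, Finset.mem_filter.2 ⟨hp, hb⟩, Fintype.mem_piFinset.2 fun h => ?_⟩
    split_ifs with hbad
    · exact Finset.mem_univ _
    · rw [hu h hbad]
      exact Finset.mem_singleton_self _

/-- Values modulo `K` depend only on the `d + 2` coefficients modulo `K`. -/
theorem exists_card_polynomial_mod_words_le (d : ℕ) {K : ℕ} (hK : 0 < K) (ℓ : ℕ) :
    ∃ S : Finset (Fin ℓ → ℕ), S.card ≤ K ^ (d + 2) ∧ ∀ R : ℤ[X], R.natDegree ≤ d + 1 →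
      (fun h : Fin ℓ => (R.eval ((h : ℕ) : ℤ) % K).toNat) ∈ S := by
  classical
  refine ⟨(Fintype.piFinset fun _ : Fin (d + 2) => Finset.range K).image fun c h =>
    ((∑ j : Fin (d + 2), (c j : ℤ) * ((h : ℕ) : ℤ) ^ (j : ℕ)) % K).toNat, ?_, fun R hR => ?_⟩
  · refine Finset.card_image_le.trans ?_
    rw [Fintype.card_piFinset_const, Finset.card_range]
  · rw [Finset.mem_image]
    have hK' : (0 : ℤ) < K := by exact_mod_cast hK
    refine ⟨fun j => (R.coeff j % K).toNat, ?_, ?_⟩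
    · rw [Fintype.mem_piFinset]
      intro j
      rw [Finset.mem_range]
      have := Int.emod_lt_of_pos (R.coeff j) hK'
      omega
    · funext h
      congr 1
      rw [eval_eq_sum_range' (show R.natDegree < d + 2 by omega), Finset.sum_range]
      change _ ≡ _ [ZMOD K]
      refine Int.ModEq.sum fun j _ => ?_
      refine Int.ModEq.mul_right _ ?_
      rw [Int.toNat_of_nonneg (Int.emod_nonneg _ hK'.ne')]
      exact Int.mod_modEq _ _

/-- For composite `k`, `y` may share factors with `k`. But some prime power `p ^ e` divides `k` and
not `y`, so `y` absorbs at most `e - 1` of the `e * m` factors `p` and at least `m - 1` are left to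
`N`. -/
theorem le_of_pow_dvd_mul_of_not_dvd {k m N y : ℕ} (hN : N ≠ 0) (hy : ¬ k ∣ y)
    (h : k ^ m ∣ N * y) : 2 ^ (m - 1) ≤ N := by
  rw [Nat.dvd_iff_prime_pow_dvd_dvd] at hy
  push Not at hy
  obtain ⟨p, e, hp, hpk, hpy⟩ := hy
  have hy0 : y ≠ 0 := fun h0 => hpy (h0 ▸ dvd_zero _)
  have he : 0 < e := Nat.pos_of_ne_zero fun h0 => hpy (by simp [h0])
  have h1 : p ^ (e * m) ∣ N * y := by
    rw [pow_mul]
    exact (pow_dvd_pow_of_dvd hpk m).trans h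
  rw [hp.pow_dvd_iff_le_factorization (mul_ne_zero hN hy0), Nat.factorization_mul hN hy0] at h1
  rw [hp.pow_dvd_iff_le_factorization hy0] at hpy
  simp only [Finsupp.add_apply] at h1
  have h2 : m - 1 ≤ N.factorization p := by
    rcases m with _ | m
    · simp
    · rw [Nat.add_sub_cancel]
      have : m ≤ e * m := Nat.le_mul_of_pos_left _ he
      rw [mul_add, mul_one] at h1
      omega
  calc 2 ^ (m - 1) ≤ p ^ (m - 1) := Nat.pow_le_pow_left hp.two_le _
    _ ≤ N := Nat.le_of_dvd (Nat.pos_of_ne_zero hN)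
      ((hp.pow_dvd_iff_le_factorization hN).2 h2)

/-- The asymptotic bound passes to a full period, hence to every `N` with an error of one incomplete
period. The threshold thus depends on `M` alone, which gives uniformity over polynomials. -/
theorem norm_sum_le_of_periodic {u : ℕ → ℂ} (hu : ∀ n, ‖u n‖ = 1) {M : ℕ} (hM : 0 < M)
    (hper : ∀ i r, u (M * i + r) = u r) {η : ℝ} (hη : 0 ≤ η)
    (h : ∀ᶠ N : ℕ in atTop, ‖∑ n ∈ Finset.range N, u n‖ ≤ η * N) (N : ℕ) :
    ‖∑ n ∈ Finset.range N, u n‖ ≤ η * N + M := by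
  have hsum : ∀ m, ∑ n ∈ Finset.range (M * m), u n = m * ∑ n ∈ Finset.range M, u n := by
    intro m
    rw [sum_range_mul_eq]
    simp_rw [hper]
    simp [Finset.mul_sum]
  obtain ⟨N₀, hN₀⟩ := eventually_atTop.1 h
  have hS : ‖∑ n ∈ Finset.range M, u n‖ ≤ η * M := by
    have h1 := hN₀ (M * (N₀ + 1)) (by nlinarith)
    rw [hsum, norm_mul, Complex.norm_natCast] at h1
    have h2 : (0 : ℝ) < (N₀ + 1 : ℕ) := by positivity
    refine le_of_mul_le_mul_left (h1.trans (le_of_eq ?_)) h2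
    push_cast
    ring
  rw [← Nat.div_add_mod N M, Finset.sum_range_add, hsum]
  refine (norm_add_le _ _).trans ?_
  have h1 : ‖∑ n ∈ Finset.range (N % M), u (M * (N / M) + n)‖ ≤ M := by
    refine (norm_sum_le _ _).trans ?_
    simp only [hu, Finset.sum_const, Finset.card_range, nsmul_eq_mul, mul_one]
    exact_mod_cast (Nat.mod_lt _ hM).le
  have h2 : ‖((N / M : ℕ) : ℂ) * ∑ n ∈ Finset.range M, u n‖ ≤ (N / M : ℕ) * (η * M) := by
    rw [norm_mul, Complex.norm_natCast]
    gcongr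
  have h3 : (0 : ℝ) ≤ η * (N % M : ℕ) := by positivity
  push_cast
  nlinarith

theorem eval_intPolynomial_real (R : ℤ[X]) (h : ℕ) :
    (R.map (Int.castRingHom ℝ)).eval (h : ℝ) = (R.eval (h : ℤ) : ℤ) := by
  rw [eval_map, ← Int.cast_natCast h, ← eq_intCast (Int.castRingHom ℝ) (h : ℤ), eval₂_at_apply]
  simp

/-- For integer polynomials whose nonconstant coefficients are not all divisible by `k`, the
exponential sums modulo a large power of `k` are uniformly small. -/
theorem exists_modulus_small_sums (d : ℕ) {k K : ℕ} (hk : 2 ≤ k) (hK : 0 < K) :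
    ∃ m₁ : ℕ, ∀ m ≥ m₁, ∃ ℓ₀ : ℕ, ∀ R : ℤ[X], R.natDegree ≤ d + 1 →
      (∃ j, 0 < j ∧ ¬ (k : ℤ) ∣ R.coeff j) → ∀ ℓ ≥ ℓ₀, ∀ t : ℕ, 0 < t → t < K →
        ‖∑ h ∈ Finset.range ℓ, expi (t * ((R.eval (h : ℤ) : ℤ) / (k ^ m : ℕ)))‖ ≤ ℓ / K := by
  have hK' : (0 : ℝ) < K := by exact_mod_cast hK
  obtain ⟨Q, hQ, hweyl⟩ := weyl_dichotomy d (ε := 1 / (2 * K)) (by positivity)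
  -- In the rational case `k ^ m` would divide `q * t` times a coefficient not divisible by `k`,
  -- forcing `2 ^ (m - 1) ≤ Q * K`, which fails for these `m`. For `ℓ ≥ 2 * K * k ^ m` the
  -- incomplete period costs at most `ℓ / (2 * K)`.
  refine ⟨Q * K + 1, fun m hm => ⟨2 * K * k ^ m, fun R hR hRk ℓ hℓ t ht htK => ?_⟩⟩
  have hM : 0 < k ^ m := by positivity
  have hM' : ((k ^ m : ℕ) : ℝ) ≠ 0 := by exact_mod_cast hM.ne'
  set P : ℝ[X] := C ((t : ℝ) / (k ^ m : ℕ)) * R.map (Int.castRingHom ℝ) with hP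
  have hPeval : ∀ h : ℕ, P.eval (h : ℝ) = t * ((R.eval (h : ℤ) : ℤ) / (k ^ m : ℕ)) := by
    intro h
    rw [hP, eval_C_mul, eval_intPolynomial_real]
    ring
  have hPdeg : P.natDegree ≤ d + 1 :=
    (natDegree_C_mul_le _ _).trans (natDegree_map_le.trans hR)
  rcases hweyl P hPdeg with ⟨q, hq, hqQ, W, b, hW⟩ | h
  · exfalso
    obtain ⟨j, hj, hjk⟩ := hRk
    have h1 := congrArg (fun S : ℝ[X] => S.coeff j) hW
    simp only [hP, coeff_C_mul, coeff_map, eq_intCast, coeff_add, coeff_C, hj.ne', if_false,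
      add_zero] at h1
    have h2 : ((q * t : ℕ) : ℤ) * R.coeff j = (k ^ m : ℕ) * W.coeff j := by
      have : ((q * t : ℕ) : ℝ) * R.coeff j = (k ^ m : ℕ) * W.coeff j := by
        rw [← h1]
        field_simp
        push_cast
        ring
      exact_mod_cast this
    have h3 : k ^ m ∣ (q * t) * (R.coeff j).natAbs := by
      have : ((k ^ m : ℕ) : ℤ) ∣ ((q * t : ℕ) : ℤ) * R.coeff j := ⟨_, h2⟩
      have := Int.natAbs_dvd_natAbs.2 this
      rwa [Int.natAbs_mul, Int.natAbs_natCast, Int.natAbs_natCast] at this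
    have h4 := le_of_pow_dvd_mul_of_not_dvd (by positivity)
      (fun h => hjk (Int.natCast_dvd.2 h)) h3
    have h5 : q * t ≤ Q * K := Nat.mul_le_mul hqQ htK.le
    have h6 : Q * K < 2 ^ (m - 1) := Nat.lt_two_pow_self.trans_le
      (Nat.pow_le_pow_right (by norm_num) (by omega))
    omega
  · simp_rw [hPeval] at h
    have hper : ∀ i r : ℕ, expi (t * ((R.eval ((k ^ m * i + r : ℕ) : ℤ) : ℤ) / (k ^ m : ℕ))) =
        expi (t * ((R.eval (r : ℤ) : ℤ) / (k ^ m : ℕ))) := by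
      intro i r
      obtain ⟨w, hw⟩ : ((k ^ m : ℕ) : ℤ) ∣ R.eval ((k ^ m * i + r : ℕ) : ℤ) - R.eval (r : ℤ) := by
        refine dvd_trans ?_ (R.sub_dvd_eval_sub _ _)
        refine ⟨i, ?_⟩
        push_cast
        ring
      rw [sub_eq_iff_eq_add] at hw
      rw [hw, ← expi_add_intCast (t * ((R.eval (r : ℤ) : ℤ) / (k ^ m : ℕ))) (t * w)]
      congr 1
      push_cast at hM' ⊢
      field_simp
      ring
    have h1 := norm_sum_le_of_periodic (fun n => norm_expi _) hM hper (by positivity) h ℓ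
    refine h1.trans ?_
    have h2 : ((2 * K * k ^ m : ℕ) : ℝ) ≤ ℓ := by exact_mod_cast hℓ
    push_cast at h2 ⊢
    rw [le_div_iff₀ hK', add_mul]
    field_simp
    linarith

/-- Pulling out the common power of `k` from the nonconstant coefficients. -/
theorem exists_eq_C_add_pow_mul {k : ℕ} (hk : 2 ≤ k) {R : ℤ[X]} (hR : ∃ j, 0 < j ∧ R.coeff j ≠ 0) :
    ∃ (L r : ℕ) (R' : ℤ[X]), r < k ^ L ∧ R = C (r : ℤ) + C ((k ^ L : ℕ) : ℤ) * R' ∧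
      ∃ j, 0 < j ∧ ¬ (k : ℤ) ∣ R'.coeff j := by
  classical
  obtain ⟨j₀, hj₀, hne⟩ := hR
  obtain ⟨L, hL, hL'⟩ : ∃ L : ℕ, (∀ j, 0 < j → ((k ^ L : ℕ) : ℤ) ∣ R.coeff j) ∧
      ¬ ∀ j, 0 < j → ((k ^ (L + 1) : ℕ) : ℤ) ∣ R.coeff j := by
    by_contra! hcon
    have hall : ∀ L : ℕ, ∀ j, 0 < j → ((k ^ L : ℕ) : ℤ) ∣ R.coeff j := by
      intro L
      induction L with
      | zero => simp
      | succ L ih => exact hcon L ih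
    have h1 := Int.natCast_dvd.1 (hall (R.coeff j₀).natAbs j₀ hj₀)
    have h2 := Nat.le_of_dvd (Int.natAbs_pos.2 hne) h1
    exact absurd h2 (not_le.2 (Nat.lt_pow_self (by omega)))
  have hM : 0 < k ^ L := by positivity
  have hM' : (0 : ℤ) < ((k ^ L : ℕ) : ℤ) := by exact_mod_cast hM
  set r : ℕ := (R.coeff 0 % (k ^ L : ℕ)).toNat with hr
  have hr' : (r : ℤ) = R.coeff 0 % (k ^ L : ℕ) :=
    Int.toNat_of_nonneg (Int.emod_nonneg _ hM'.ne')
  obtain ⟨R', hR'⟩ : C ((k ^ L : ℕ) : ℤ) ∣ R - C (r : ℤ) := by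
    rw [C_dvd_iff_dvd_coeff]
    intro j
    rcases Nat.eq_zero_or_pos j with rfl | hj
    · rw [coeff_sub, coeff_C_zero, hr']
      exact Int.dvd_self_sub_emod
    · rw [coeff_sub, coeff_C, if_neg hj.ne', sub_zero]
      exact hL j hj
  refine ⟨L, r, R', ?_, by rw [← hR']; ring, ?_⟩
  · have := Int.emod_lt_of_pos (R.coeff 0) hM'
    omega
  · push Not at hL'
    obtain ⟨j, hj, hnd⟩ := hL'
    refine ⟨j, hj, fun h => hnd ?_⟩
    have h1 := congrArg (fun S : ℤ[X] => S.coeff j) hR'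
    simp only [coeff_sub, coeff_C, hj.ne', if_false, sub_zero, coeff_C_mul] at h1
    rw [h1, pow_succ, Nat.cast_mul]
    exact mul_dvd_mul_left _ h

/-- Bounds the free choices of one of `N` states at the bad positions; `52 * δ * ℓ` is the count
from `card_filter_floor_fract_le`. -/
theorem exists_pos_pow_floor_le (N : ℕ) (hN : 0 < N) {ε : ℝ} (hε : 0 < ε) :
    ∃ δ : ℝ, 0 < δ ∧ ∀ ℓ : ℕ, (N : ℝ) ^ ⌊52 * δ * ℓ⌋₊ ≤ Real.exp (ε * ℓ) := by
  have hN' : (1 : ℝ) ≤ N := by exact_mod_cast hN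
  have hlog : 0 ≤ Real.log N := Real.log_nonneg hN'
  refine ⟨ε / (52 * (Real.log N + 1)), by positivity, fun ℓ => ?_⟩
  rw [← Real.exp_log (by linarith : (0 : ℝ) < N), ← Real.exp_nat_mul, Real.log_exp]
  refine Real.exp_le_exp.2 ?_
  calc (⌊52 * (ε / (52 * (Real.log N + 1))) * ℓ⌋₊ : ℝ) * Real.log N
      ≤ 52 * (ε / (52 * (Real.log N + 1))) * ℓ * Real.log N := by
        gcongr
        exact Nat.floor_le (by positivity)
    _ = ε * ℓ * (Real.log N / (Real.log N + 1)) := by field_simp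
    _ ≤ ε * ℓ * 1 := by
        gcongr
        rw [div_le_one (by linarith)]
        linarith
    _ = ε * ℓ := mul_one _

theorem eventually_le_exp_mul (C : ℝ) {ε : ℝ} (hε : 0 < ε) :
    ∀ᶠ ℓ : ℕ in atTop, C ≤ Real.exp (ε * ℓ) :=
  (Real.tendsto_exp_atTop.comp
    (tendsto_natCast_atTop_atTop.const_mul_atTop hε)).eventually_ge_atTop C

/-- If reading digits synchronizes, then the state sequence along integer polynomials of bounded
degree has few words. -/
theorem eventually_card_polynomial_words_le {τ : Type*} [Finite τ] {k : ℕ} (hk : 2 ≤ k)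
    {step : τ → ℕ → τ} {f : ℕ → τ} (hf : ∀ n d, d < k → f (k * n + d) = step (f n) d)
    (hbad : ∀ δ : ℝ, 0 < δ →
      ∃ m, 6 ≤ k ^ m ∧ ((badResidues k step m).card : ℝ) ≤ δ * (k : ℝ) ^ m)
    (d : ℕ) {ε : ℝ} (hε : 0 < ε) :
    ∀ᶠ ℓ : ℕ in atTop, ∃ S : Finset (Fin ℓ → τ), (S.card : ℝ) ≤ Real.exp (ε * ℓ) ∧
      ∀ R : ℤ[X], R.natDegree ≤ d + 1 → (∀ h < ℓ, 0 ≤ R.eval (h : ℤ)) →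
        (fun h : Fin ℓ => f (R.eval ((h : ℕ) : ℤ)).toNat) ∈ S := by
  classical
  have := Fintype.ofFinite τ
  have : Nonempty τ := ⟨f 0⟩
  have hk0 : 0 < k := by omega
  obtain ⟨δ, hδ, hpow⟩ := exists_pos_pow_floor_le (Fintype.card τ) Fintype.card_pos (half_pos hε)
  obtain ⟨m₀, hm₀, hB⟩ := hbad δ hδ
  set K := k ^ m₀ with hK
  obtain ⟨m₁, hm₁⟩ := exists_modulus_small_sums d hk (by omega : 0 < K)
  obtain ⟨ℓ₀, hℓ₀⟩ := hm₁ (m₀ + m₁) (by omega)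
  set m := m₀ + m₁ with hm
  have hKpos : (0 : ℝ) < K := by exact_mod_cast (by omega : 0 < K)
  have hM : 0 < k ^ m := by positivity
  have hBK : ((badResidues k step m₀).card : ℝ) / K ≤ δ := by
    rw [div_le_iff₀ hKpos, hK]
    push_cast
    exact hB
  set Cst : ℝ := ((Fintype.card (τ → τ) * (k ^ m) ^ (d + 2) + Fintype.card τ : ℕ) : ℝ)
  filter_upwards [eventually_ge_atTop ℓ₀, eventually_le_exp_mul Cst (half_pos hε)] with ℓ hℓ hC
  set b := ⌊52 * δ * ℓ⌋₊ with hb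
  obtain ⟨patterns, hpc, hpat⟩ := exists_card_polynomial_mod_words_le d hM ℓ
  -- For `R = r + k ^ L * R'` neither `L` nor `r` is bounded, but they enter only through the
  -- self-map `g` of `τ` given by reading the digits of `r`, and there are finitely many such maps.
  -- Whether `z` is bad is decided by the upper `m₀` of its `m` digits.
  have hS := fun g : τ → τ => exists_card_words_of_patterns_le patterns
    (fun z => g (readDigits k step m z (f 0)))
    (fun z => z / k ^ m₁ ∈ badResidues k step m₀) b
  choose S hSc hS using hS
  -- The constant words account for constant polynomials.
  refine ⟨Finset.univ.biUnion S ∪ Finset.univ.image fun s _ => s, ?_, ?_⟩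
  · have h1 : (Finset.univ.biUnion S ∪ Finset.univ.image fun (s : τ) (_ : Fin ℓ) => s).card ≤
        Fintype.card (τ → τ) * ((k ^ m) ^ (d + 2) * Fintype.card τ ^ b) + Fintype.card τ := by
      refine (Finset.card_union_le _ _).trans (add_le_add ?_ Finset.card_image_le)
      exact Finset.card_biUnion_le_card_mul _ _ _ fun g _ =>
        (hSc g).trans (Nat.mul_le_mul_right _ hpc)
    have h2 : 1 ≤ Fintype.card τ ^ b := Nat.one_le_pow _ _ Fintype.card_pos
    have h3 : Fintype.card (τ → τ) * ((k ^ m) ^ (d + 2) * Fintype.card τ ^ b) + Fintype.card τ ≤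
        (Fintype.card (τ → τ) * (k ^ m) ^ (d + 2) + Fintype.card τ) * Fintype.card τ ^ b := by
      nlinarith [Fintype.card_pos (α := τ)]
    calc _ ≤ ((((Fintype.card (τ → τ) * (k ^ m) ^ (d + 2) + Fintype.card τ : ℕ) *
          Fintype.card τ ^ b : ℕ)) : ℝ) := by exact_mod_cast h1.trans h3
      _ = Cst * (Fintype.card τ : ℝ) ^ b := by rw [Nat.cast_mul, Nat.cast_pow]
      _ ≤ Real.exp (ε / 2 * ℓ) * Real.exp (ε / 2 * ℓ) :=
          mul_le_mul hC (hpow ℓ) (by positivity) (by positivity)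
      _ = _ := by rw [← Real.exp_add]; congr 1; ring
  · intro R hR hRpos
    rw [Finset.mem_union]
    by_cases hne : ∃ j, 0 < j ∧ R.coeff j ≠ 0
    · left
      obtain ⟨L, r, R', hr, hRR', hndvd⟩ := exists_eq_C_add_pow_mul hk hne
      have hkL : 0 < k ^ L := by positivity
      have hR'deg : R'.natDegree ≤ d + 1 := by
        rw [natDegree_le_iff_coeff_eq_zero]
        intro j hj
        have h1 := coeff_eq_zero_of_natDegree_lt (hR.trans_lt hj)
        rw [hRR', coeff_add, coeff_C, if_neg (by omega), coeff_C_mul, zero_add] at h1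
        rcases mul_eq_zero.1 h1 with h2 | h2
        · exact absurd h2 (by exact_mod_cast hkL.ne')
        · exact h2
      have heval : ∀ h : ℕ, R.eval (h : ℤ) = r + (k ^ L : ℕ) * R'.eval (h : ℤ) := by
        intro h
        conv_lhs => rw [hRR']
        rw [eval_add, eval_mul, eval_C, eval_C]
      have hR'pos : ∀ h < ℓ, 0 ≤ R'.eval (h : ℤ) := by
        intro h hh
        have h1 := hRpos h hh
        rw [heval] at h1
        by_contra! hc
        have h2 : (r : ℤ) < (k ^ L : ℕ) := by exact_mod_cast hr
        nlinarith
      have hstate : ∀ h < ℓ, f (R.eval (h : ℤ)).toNat =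
          readDigits k step L r (f (R'.eval (h : ℤ)).toNat) := by
        intro h hh
        obtain ⟨v, hv⟩ := Int.eq_ofNat_of_zero_le (hR'pos h hh)
        have h1 : (R.eval (h : ℤ)).toNat = r + k ^ L * v := by
          rw [heval, hv]
          exact_mod_cast Int.toNat_natCast (r + k ^ L * v)
        rw [h1, hv, Int.toNat_natCast, apply_eq_readDigits hk0 hf L, ← readDigits_mod,
          Nat.add_mul_mod_self_left, Nat.mod_eq_of_lt hr, Nat.add_mul_div_left _ _ hkL,
          Nat.div_eq_of_lt hr, zero_add]
      rw [Finset.mem_biUnion]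
      refine ⟨readDigits k step L r, Finset.mem_univ _, hS _ _ (hpat R' hR'deg) ?_ _ ?_⟩
      · have h1 := card_filter_floor_fract_le (ℓ := ℓ) hm₀ (badResidues k step m₀)
          (x := fun h => (R'.eval (h : ℤ) : ℤ) / (k ^ m : ℕ)) (hℓ₀ R' hR'deg hndvd ℓ hℓ)
        have h2 : ∀ h : ℕ, ⌊(K : ℝ) * Int.fract (((R'.eval (h : ℤ) : ℤ) : ℝ) / (k ^ m : ℕ))⌋₊ =
            (R'.eval (h : ℤ) % (k ^ m : ℕ)).toNat / k ^ m₁ := by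
          intro h
          rw [← Nat.floor_div_eq_div (K := ℝ)]
          congr 1
          have h3 : (((R'.eval (h : ℤ) % (k ^ m : ℕ)).toNat : ℕ) : ℝ) =
              ((R'.eval (h : ℤ) % (k ^ m : ℕ) : ℤ) : ℝ) := by
            rw [← Int.cast_natCast, Int.toNat_of_nonneg
              (Int.emod_nonneg _ (by exact_mod_cast hM.ne'))]
          rw [h3, Int.fract_div_intCast_eq_div_intCast_mod, hK, hm]
          push_cast
          rw [pow_add]
          have : (k : ℝ) ≠ 0 := by positivity
          field_simp
          ring
        have h4 : (Finset.univ.filter fun h : Fin ℓ =>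
            (R'.eval ((h : ℕ) : ℤ) % (k ^ m : ℕ)).toNat / k ^ m₁ ∈ badResidues k step m₀).card =
            ((Finset.range ℓ).filter fun h : ℕ => ⌊(K : ℝ) * Int.fract
              (((R'.eval (h : ℤ) : ℤ) : ℝ) / (k ^ m : ℕ))⌋₊ ∈ badResidues k step m₀).card := by
          simp_rw [h2]
          rw [Finset.card_filter, Finset.card_filter, Finset.sum_range]
        rw [h4, hb]
        refine Nat.le_floor (h1.trans ?_)
        gcongr
      · intro h hgood
        rw [hstate h h.2]
        congr 1
        set z := (R'.eval ((h : ℕ) : ℤ) % (k ^ m : ℕ)).toNat with hz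
        obtain ⟨v, hv⟩ := Int.eq_ofNat_of_zero_le (hR'pos h h.2)
        have hzv : z = v % k ^ m := by
          rw [hz, hv, ← Int.natCast_mod, Int.toNat_natCast]
        have hzlt : z < k ^ m := hzv ▸ Nat.mod_lt _ hM
        have hzdiv : z / k ^ m₁ < k ^ m₀ := by
          rw [Nat.div_lt_iff_lt_mul (by positivity), ← pow_add]
          exact hzlt
        rw [hv, Int.toNat_natCast, apply_eq_readDigits hk0 hf m, ← readDigits_mod, ← hzv, hm,
          readDigits_add, readDigits_add]
        congr 1
        refine readDigits_eq_of_not_mem_badResidues hk0 ?_ _ _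
        rwa [Nat.mod_eq_of_lt hzdiv]
    · right
      push Not at hne
      rw [Finset.mem_image]
      refine ⟨f (R.coeff 0).toNat, Finset.mem_univ _, ?_⟩
      funext h
      have : R = C (R.coeff 0) := by
        ext j
        rcases Nat.eq_zero_or_pos j with rfl | hj
        · simp
        · rw [hne j hj, coeff_C, if_neg hj.ne']
      conv_rhs => rw [this]
      rw [eval_C]

/-! ### Complexity from windows -/

/-- The list of the `N` consecutive values of `U` starting at `n`. -/
def factorWord {τ : Type*} (U : ℕ → τ) (n N : ℕ) : List τ := (List.range N).map fun i => U (n + i)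

theorem factorWord_add {τ : Type*} (U : ℕ → τ) (n N N' : ℕ) :
    factorWord U n (N + N') = factorWord U n N ++ factorWord U (n + N) N' := by
  simp [factorWord, List.range_add, add_assoc]

theorem factorWord_eq_ofFn {τ : Type*} (U : ℕ → τ) (n N : ℕ) :
    factorWord U n N = List.ofFn fun i : Fin N => U (n + i) := by
  rw [factorWord, List.ofFn_eq_map, ← List.map_coe_finRange_eq_range, List.map_map]
  rfl

theorem sum_exp_neg_le_one {ε : ℝ} (hε : 0 < ε) :
    ∃ H₀ : ℕ, ∀ H₁ ≥ H₀, ∀ H₂, ∑ ℓ ∈ Finset.Icc H₁ H₂, Real.exp (-(ε * ℓ)) ≤ 1 := by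
  have hs : Summable fun ℓ : ℕ => Real.exp (-(ε * ℓ)) := by
    have : ∀ ℓ : ℕ, Real.exp (-(ε * ℓ)) = Real.exp (-ε) ^ ℓ := by
      intro ℓ
      rw [← Real.exp_nat_mul]
      congr 1
      ring
    simp_rw [this]
    exact summable_geometric_of_lt_one (Real.exp_pos _).le (by simpa using hε)
  obtain ⟨s, hs⟩ := summable_iff_vanishing_norm.1 hs 1 one_pos
  obtain ⟨H₀, hH₀⟩ := s.exists_nat_subset_range
  refine ⟨H₀, fun H₁ hH₁ H₂ => ?_⟩
  refine (le_abs_self _).trans (hs _ ?_).le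
  rw [Finset.disjoint_left]
  intro x hx hxs
  have := Finset.mem_range.1 (hH₀ hxs)
  have := (Finset.mem_Icc.1 hx).1
  omega

/-- If every window starts with a word from a small collection of words of bounded length, then
there are few words. -/
theorem exists_card_factorWords_le {τ : Type*} [Finite τ] {U : ℕ → τ} {ε : ℝ} (hε : 0 < ε)
    {H₁ H₂ n₀ : ℕ} (hH₁ : 0 < H₁)
    (hsum : ∑ ℓ ∈ Finset.Icc H₁ H₂, Real.exp (-(ε * ℓ)) ≤ 1)
    (G : ∀ ℓ : ℕ, Finset (Fin ℓ → τ))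
    (hG : ∀ ℓ, H₁ ≤ ℓ → ((G ℓ).card : ℝ) ≤ Real.exp (ε * ℓ))
    (hU : ∀ n ≥ n₀, ∃ ℓ, H₁ ≤ ℓ ∧ ℓ ≤ H₂ ∧ (fun i : Fin ℓ => U (n + i)) ∈ G ℓ) :
    ∃ C : ℝ, ∀ N : ℕ, ∃ T : Finset (List τ), (T.card : ℝ) ≤ C * Real.exp (2 * ε * N) ∧
      ∀ n ≥ n₀, factorWord U n N ∈ T := by
  classical
  have := Fintype.ofFinite τ
  have : Nonempty τ := ⟨U 0⟩
  refine ⟨(Fintype.card τ : ℝ) ^ H₂, fun N => ?_⟩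
  have hC : (1 : ℝ) ≤ Fintype.card τ := by exact_mod_cast Fintype.card_pos (α := τ)
  induction N using Nat.strong_induction_on with
  | _ N ih =>
    rcases le_or_gt N H₂ with hN | hN
    · refine ⟨(Finset.univ : Finset (Fin N → τ)).image List.ofFn, ?_, fun n _ => ?_⟩
      · have h1 : (((Finset.univ : Finset (Fin N → τ)).image List.ofFn).card : ℝ) ≤
            (Fintype.card τ : ℝ) ^ N := by
          have := Finset.card_image_le (s := (Finset.univ : Finset (Fin N → τ))) (f := List.ofFn)
          rw [Finset.card_univ, Fintype.card_fun, Fintype.card_fin] at this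
          exact_mod_cast this
        refine h1.trans ((pow_le_pow_right₀ hC hN).trans (le_mul_of_one_le_right (by positivity) ?_))
        exact Real.one_le_exp (by positivity)
      · rw [factorWord_eq_ofFn]
        exact Finset.mem_image_of_mem _ (Finset.mem_univ _)
    · have ih' : ∀ ℓ, ∃ T : Finset (List τ), H₁ ≤ ℓ ∧ ℓ ≤ H₂ →
          (T.card : ℝ) ≤ (Fintype.card τ : ℝ) ^ H₂ * Real.exp (2 * ε * (N - ℓ : ℕ)) ∧
            ∀ n ≥ n₀, factorWord U n (N - ℓ) ∈ T := by
        intro ℓ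
        by_cases hℓ : H₁ ≤ ℓ ∧ ℓ ≤ H₂
        · obtain ⟨T, hT⟩ := ih (N - ℓ) (by omega)
          exact ⟨T, fun _ => hT⟩
        · exact ⟨∅, fun h => absurd h hℓ⟩
      choose T hT using ih'
      -- Split off the first window. Length `ℓ` contributes at most `exp (ε * ℓ)` times the bound
      -- for `N - ℓ`, that is `exp (-(ε * ℓ))` times the bound for `N`; by `hsum` these weights add
      -- up to at most 1.
      refine ⟨(Finset.Icc H₁ H₂).biUnion fun ℓ =>
        (((G ℓ).image List.ofFn) ×ˢ T ℓ).image fun p => p.1 ++ p.2, ?_, fun n hn => ?_⟩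
      · calc _ ≤ ∑ ℓ ∈ Finset.Icc H₁ H₂, ((((((G ℓ).image List.ofFn) ×ˢ T ℓ).image
              fun p => p.1 ++ p.2).card : ℕ) : ℝ) := by
              exact_mod_cast Finset.card_biUnion_le
          _ ≤ ∑ ℓ ∈ Finset.Icc H₁ H₂, (Fintype.card τ : ℝ) ^ H₂ * Real.exp (2 * ε * N) *
                Real.exp (-(ε * ℓ)) := by
              refine Finset.sum_le_sum fun ℓ hℓ => ?_
              have hℓ := Finset.mem_Icc.1 hℓ
              have h1 : ((((((G ℓ).image List.ofFn) ×ˢ T ℓ).image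
                  fun p => p.1 ++ p.2).card : ℕ) : ℝ) ≤ (G ℓ).card * (T ℓ).card := by
                have := (Finset.card_image_le (s := ((G ℓ).image List.ofFn) ×ˢ T ℓ)
                  (f := fun p => p.1 ++ p.2)).trans_eq (Finset.card_product _ _)
                exact_mod_cast this.trans (Nat.mul_le_mul_right _ Finset.card_image_le)
              refine h1.trans ((mul_le_mul (hG ℓ hℓ.1) (hT ℓ hℓ).1 (by positivity)
                (by positivity)).trans (le_of_eq ?_))
              rw [mul_left_comm, mul_assoc _ (Real.exp (2 * ε * N)), ← Real.exp_add,
                ← Real.exp_add, Nat.cast_sub (by omega : ℓ ≤ N)]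
              congr 2
              ring
          _ ≤ _ := by
              rw [← Finset.mul_sum]
              exact mul_le_of_le_one_right (by positivity) hsum
      · obtain ⟨ℓ, h1, h2, h3⟩ := hU n hn
        rw [Finset.mem_biUnion]
        refine ⟨ℓ, Finset.mem_Icc.2 ⟨h1, h2⟩, Finset.mem_image.2
          ⟨(factorWord U n ℓ, factorWord U (n + ℓ) (N - ℓ)), ?_, ?_⟩⟩
        · rw [Finset.mem_product]
          refine ⟨?_, (hT ℓ ⟨h1, h2⟩).2 _ (by omega)⟩
          rw [factorWord_eq_ofFn]
          exact Finset.mem_image_of_mem _ h3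
        · rw [← factorWord_add]
          congr 1
          omega

theorem isDeterministic_of_card_factorWords_le {τ A : Type*} [Finite τ] {U : ℕ → τ} {out : τ → A}
    (h : ∀ ε : ℝ, 0 < ε → ∃ (n₀ : ℕ) (C : ℝ), ∀ N : ℕ, ∃ T : Finset (List τ),
      (T.card : ℝ) ≤ C * Real.exp (2 * ε * N) ∧ ∀ n ≥ n₀, factorWord U n N ∈ T) :
    IsDeterministic fun n => out (U n) := by
  classical
  have hfin : (Set.range fun n => out (U n)).Finite :=
    (Set.finite_range out).subset (by rintro _ ⟨n, rfl⟩; exact ⟨_, rfl⟩)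
  refine ⟨hfin, ?_⟩
  have hpos : ∀ N, 1 ≤ subwordComplexity (fun n => out (U n)) N := by
    intro N
    refine (Set.ncard_pos ?_).2 ⟨_, ⟨0, rfl⟩⟩
    refine (Set.Finite.pi' fun _ : Fin N => hfin).subset ?_
    rintro _ ⟨n, rfl⟩ i
    exact ⟨_, rfl⟩
  rw [Metric.tendsto_atTop]
  intro ε hε
  obtain ⟨n₀, C, hT⟩ := h (ε / 8) (by positivity)
  set D : ℝ := max C 1 + n₀ with hD
  have hD1 : 1 ≤ D := by
    have := le_max_right C 1
    have := Nat.cast_nonneg (α := ℝ) n₀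
    linarith
  have hbound : ∀ N : ℕ, (subwordComplexity (fun n => out (U n)) N : ℝ) ≤
      D * Real.exp (ε / 4 * N) := by
    intro N
    obtain ⟨T, hTc, hTm⟩ := hT N
    have h1 : subwords (fun n => out (U n)) N ⊆
        ((T.image fun l (i : Fin N) => out (l.getD i (U 0))) ∪
          (Finset.range n₀).image fun n (i : Fin N) => out (U (n + i)) : Finset (Fin N → A)) := by
      rintro _ ⟨n, rfl⟩
      rw [Finset.mem_coe, Finset.mem_union]
      rcases lt_or_ge n n₀ with hn | hn
      · right
        exact Finset.mem_image.2 ⟨n, Finset.mem_range.2 hn, rfl⟩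
      · left
        refine Finset.mem_image.2 ⟨_, hTm n hn, ?_⟩
        funext i
        simp [factorWord]
    have h2 : subwordComplexity (fun n => out (U n)) N ≤ T.card + n₀ := by
      refine (Set.ncard_le_ncard h1 (Finset.finite_toSet _)).trans ?_
      rw [Set.ncard_coe_finset]
      refine (Finset.card_union_le _ _).trans (add_le_add Finset.card_image_le ?_)
      exact Finset.card_image_le.trans (Finset.card_range _).le
    have h3 : (subwordComplexity (fun n => out (U n)) N : ℝ) ≤ T.card + n₀ := by exact_mod_cast h2
    have h4 : (1 : ℝ) ≤ Real.exp (ε / 4 * N) := Real.one_le_exp (by positivity)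
    have h5 : 2 * (ε / 8) * (N : ℝ) = ε / 4 * N := by ring
    rw [h5] at hTc
    have h6 : C * Real.exp (ε / 4 * N) ≤ max C 1 * Real.exp (ε / 4 * N) := by
      gcongr
      exact le_max_left _ _
    have h7 : (n₀ : ℝ) ≤ n₀ * Real.exp (ε / 4 * N) :=
      le_mul_of_one_le_right (Nat.cast_nonneg _) h4
    rw [hD, add_mul]
    linarith
  obtain ⟨N₀, hN₀⟩ := exists_nat_gt (4 * Real.log D / ε)
  refine ⟨max N₀ 1, fun N hN => ?_⟩
  have hN1 : (0 : ℝ) < N := by exact_mod_cast (le_max_right N₀ 1).trans hN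
  have hNN₀ : (N₀ : ℝ) ≤ N := by exact_mod_cast (le_max_left N₀ 1).trans hN
  have hp : (1 : ℝ) ≤ subwordComplexity (fun n => out (U n)) N := by exact_mod_cast hpos N
  have hlog := Real.log_le_log (by linarith) (hbound N)
  rw [Real.log_mul (by positivity) (Real.exp_pos _).ne', Real.log_exp] at hlog
  have hlog0 := Real.log_nonneg hp
  rw [Real.dist_eq, sub_zero, abs_of_nonneg (div_nonneg hlog0 hN1.le), div_lt_iff₀ hN1]
  rw [div_lt_iff₀ hε] at hN₀
  nlinarith

/-! ### Word counts for the two kinds of windows -/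

theorem eventually_mul_pow_le_exp (C : ℝ) (E : ℕ) {ε : ℝ} (hε : 0 < ε) :
    ∀ᶠ ℓ : ℕ in atTop, C * ((ℓ : ℝ) + 1) ^ E ≤ Real.exp (ε * ℓ) := by
  have h1 : Tendsto (fun ℓ : ℕ => ε * ((ℓ : ℝ) + 1)) atTop atTop :=
    (tendsto_atTop_add_const_right _ _ tendsto_natCast_atTop_atTop).const_mul_atTop hε
  have h2 := ((Real.tendsto_exp_div_pow_atTop E).comp h1).eventually_ge_atTop
    (C / ε ^ E * Real.exp ε)
  filter_upwards [h2] with ℓ hℓ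
  simp only [Function.comp] at hℓ
  rw [le_div_iff₀ (by positivity), mul_pow, mul_add, mul_one, Real.exp_add] at hℓ
  have h3 : C / ε ^ E * Real.exp ε * (ε ^ E * ((ℓ : ℝ) + 1) ^ E) =
      C * ((ℓ : ℝ) + 1) ^ E * Real.exp ε := by field_simp
  rw [h3] at hℓ
  exact le_of_mul_le_mul_right hℓ (Real.exp_pos _)

theorem floor_mul_fract_div {K : ℕ} (hK : 0 < K) {y : ℝ} (hy : 0 ≤ y) :
    ⌊(K : ℝ) * Int.fract (y / K)⌋₊ = ⌊y⌋₊ % K := by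
  have hK' : (0 : ℝ) < K := by exact_mod_cast hK
  have h1 : (K : ℝ) * Int.fract (y / K) = y - (K * (⌊y⌋₊ / K) : ℕ) := by
    rw [← Nat.floor_div_natCast, Int.fract, mul_sub, mul_div_cancel₀ _ hK'.ne',
      ← natCast_floor_eq_intCast_floor (by positivity)]
    push_cast
    rfl
  rw [h1, Nat.floor_sub_natCast]
  have := Nat.div_add_mod ⌊y⌋₊ K
  omega

/-- On a residue class modulo `q`, dividing `W` by the denominator `q` leaves an integer polynomial
plus a constant. -/
theorem exists_comp_linear_eq {n q : ℕ} (hq : 0 < q) (r : ℕ) {W : ℤ[X]} (hW : W.natDegree ≤ n) :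
    ∃ V : ℤ[X], V.natDegree ≤ n ∧ ∀ i : ℕ,
      W.eval ((q * i + r : ℕ) : ℤ) = W.eval (r : ℤ) + q * V.eval (i : ℤ) := by
  obtain ⟨V, hV⟩ : C (q : ℤ) ∣ W.comp (C (q : ℤ) * X + C (r : ℤ)) - C (W.eval (r : ℤ)) := by
    have h1 := (W.map C).sub_dvd_eval_sub (C (q : ℤ) * X + C (r : ℤ)) (C (r : ℤ))
    rw [add_sub_cancel_right, eval_map, ← comp, eval_map, eval₂_at_apply] at h1
    exact (dvd_mul_right _ _).trans h1
  refine ⟨V, ?_, fun i => ?_⟩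
  · rw [← natDegree_C_mul (a := (q : ℤ)) (by exact_mod_cast hq.ne'), ← hV, natDegree_sub_C]
    refine natDegree_comp_le.trans ?_
    calc _ ≤ W.natDegree * 1 := Nat.mul_le_mul_left _ natDegree_linear_le
      _ ≤ n := by simpa using hW
  · have h1 := congrArg (eval (i : ℤ)) hV
    simp only [eval_sub, eval_comp, eval_add, eval_mul, eval_C, eval_X] at h1
    push_cast
    linarith

/-- The words along a sequence that is close to a rational polynomial with denominator `q` are
determined by words along integer polynomials and by residues modulo `3`. -/
theorem exists_card_near_rational_words_le {τ : Type*} [Finite τ] (f : ℕ → τ) {d ℓ q ℓ' K : ℕ}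
    (hq : 0 < q) (hℓ : ℓ = q * ℓ') (hK : 0 < K) (P₃ : Finset (Fin ℓ → ℕ))
    (I : Finset (Fin ℓ' → τ))
    (hI : ∀ R : ℤ[X], R.natDegree ≤ d + 1 → (∀ h < ℓ', 0 ≤ R.eval (h : ℤ)) →
        (fun h : Fin ℓ' => f (R.eval ((h : ℕ) : ℤ)).toNat) ∈ I) :
    ∃ S : Finset (Fin ℓ → τ), S.card ≤ P₃.card * (3 ^ (d + 2)) ^ q * I.card ^ (3 * q) ∧
      ∀ y : ℕ → ℝ, (fun h : Fin ℓ => ⌊y h⌋₊ % 3) ∈ P₃ → (∀ h < ℓ, 2 ≤ y h) →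
        (∃ W : ℤ[X], W.natDegree ≤ d + 1 ∧ ∃ b : ℝ, ∀ h < ℓ,
          |q * (y h / K) - (W.eval (h : ℤ) + b)| < 1 / K) →
        (fun h : Fin ℓ => f ⌊y h⌋₊) ∈ S := by
  classical
  have hq' : (0 : ℝ) < q := by exact_mod_cast hq
  have hK' : (0 : ℝ) < K := by exact_mod_cast hK
  obtain ⟨Z, hZc, hZ⟩ := exists_card_polynomial_mod_words_le d (by norm_num : 0 < 3) ℓ'
  let res : Fin ℓ → Fin q := fun h => ⟨h % q, Nat.mod_lt _ hq⟩
  let quo : Fin ℓ → Fin ℓ' := fun h => ⟨h / q, by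
    rw [Nat.div_lt_iff_lt_mul hq, mul_comm, ← hℓ]; exact h.2⟩
  -- In each class modulo `q`, `⌊y⌋` exceeds an integer polynomial by 0, 1 or 2, and the residues of
  -- both modulo 3 tell by how much. The `+ 3` prevents truncated subtraction.
  let dec : (Fin ℓ → ℕ) × (Fin q → Fin ℓ' → ℕ) × (Fin q × Fin 3 → Fin ℓ' → τ) → Fin ℓ → τ :=
    fun p h => p.2.2 (res h, ⟨(p.1 h + 3 - p.2.1 (res h) (quo h)) % 3, Nat.mod_lt _ (by norm_num)⟩)
      (quo h)
  refine ⟨(P₃ ×ˢ (Fintype.piFinset fun _ : Fin q => Z) ×ˢ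
    (Fintype.piFinset fun _ : Fin q × Fin 3 => I)).image dec, ?_, ?_⟩
  · refine Finset.card_image_le.trans ?_
    rw [Finset.card_product, Finset.card_product, Fintype.card_piFinset, Fintype.card_piFinset]
    simp only [Finset.prod_const, Finset.card_univ, Fintype.card_fin, Fintype.card_prod]
    rw [← mul_assoc, mul_comm q 3]
    exact Nat.mul_le_mul_right _ (Nat.mul_le_mul_left _ (Nat.pow_le_pow_left hZc _))
  · rintro y hy3 hy2 ⟨W, hW, b, hWy⟩
    choose V hVdeg hV using fun r : ℕ => exists_comp_linear_eq hq r hW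
    let γ : ℕ → ℝ := fun r => K * (W.eval (r : ℤ) + b) / q
    -- The hypothesis puts `y` within 1 of `K * V + γ`, so rounding `γ` down and subtracting 1 gives
    -- `R ≤ ⌊y⌋ ≤ R + 2`.
    let R : ℕ → ℤ[X] := fun r => C (K : ℤ) * V r + C (⌊γ r⌋ - 1)
    have hRdeg : ∀ r (s : ℤ), (R r + C s).natDegree ≤ d + 1 := by
      intro r s
      rw [natDegree_add_C]
      simp only [R]
      rw [natDegree_add_C]
      exact (natDegree_C_mul_le _ _).trans (hVdeg r)
    have hReval : ∀ r i : ℕ, (R r).eval (i : ℤ) = K * (V r).eval (i : ℤ) + (⌊γ r⌋ - 1) := by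
      intro r i
      simp only [R, eval_add, eval_mul, eval_C]
    have hfloor : ∀ r < q, ∀ i < ℓ', (R r).eval (i : ℤ) ≤ ⌊y (q * i + r)⌋ ∧
        ⌊y (q * i + r)⌋ ≤ (R r).eval (i : ℤ) + 2 ∧ 2 ≤ ⌊y (q * i + r)⌋ := by
      intro r hr i hi
      have hlt : q * i + r < ℓ := by
        rw [hℓ]
        nlinarith
      have h1 := hWy _ hlt
      have h2 : |y (q * i + r) - (K * ((V r).eval (i : ℤ) : ℤ) + γ r)| < 1 := by
        have e1 : q * (y (q * i + r) / K) - (((W.eval ((q * i + r : ℕ) : ℤ) : ℤ) : ℝ) + b) =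
            q / K * (y (q * i + r) - (K * ((V r).eval (i : ℤ) : ℤ) + γ r)) := by
          rw [hV r i]
          simp only [γ]
          push_cast
          field_simp
          ring
        rw [e1, abs_mul, abs_of_pos (by positivity), div_mul_eq_mul_div,
          div_lt_div_iff_of_pos_right hK'] at h1
        have hq1 : (1 : ℝ) ≤ q := by exact_mod_cast hq
        nlinarith [abs_nonneg (y (q * i + r) - (K * ((V r).eval (i : ℤ) : ℤ) + γ r))]
      rw [abs_lt] at h2
      have h3 := Int.floor_le (γ r)
      have h4 := Int.lt_floor_add_one (γ r)
      rw [hReval]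
      refine ⟨Int.le_floor.2 ?_, Int.lt_add_one_iff.1 (Int.floor_lt.2 ?_),
        Int.le_floor.2 (by exact_mod_cast hy2 _ hlt)⟩
      · push_cast
        linarith [h2.1]
      · push_cast
        linarith [h2.2]
    have hRpos : ∀ r < q, ∀ s : ℕ, ∀ i < ℓ', 0 ≤ (R r + C (s : ℤ)).eval (i : ℤ) := by
      intro r hr s i hi
      obtain ⟨-, h2, h3⟩ := hfloor r hr i hi
      rw [eval_add, eval_C]
      omega
    rw [Finset.mem_image]
    refine ⟨(fun h : Fin ℓ => ⌊y h⌋₊ % 3,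
      fun r i => ((R r).eval ((i : ℕ) : ℤ) % (3 : ℕ)).toNat,
      fun p i => f ((R p.1 + C (((p.2 : ℕ)) : ℤ)).eval ((i : ℕ) : ℤ)).toNat), ?_, ?_⟩
    · rw [Finset.mem_product, Finset.mem_product, Fintype.mem_piFinset, Fintype.mem_piFinset]
      refine ⟨hy3, fun r => hZ _ ?_, fun p => hI _ (hRdeg _ _) (hRpos _ p.1.2 _)⟩
      have := hRdeg r 0
      rwa [C_0, add_zero] at this
    · funext h
      obtain ⟨h1, h2, h3⟩ := hfloor (res h) (res h).2 (quo h) (quo h).2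
      have hh : q * (quo h : ℕ) + (res h : ℕ) = h := Nat.div_add_mod _ _
      rw [hh] at h1 h2 h3
      have h4 : ((⌊y h⌋₊ : ℕ) : ℤ) = ⌊y h⌋ :=
        Int.natCast_floor_eq_floor (by linarith [hy2 h h.2])
      simp only [dec]
      rw [eval_add, eval_C]
      congr 1
      omega

/-- Windows with small exponential sums contribute few words. -/
theorem eventually_card_small_sums_words_le {τ : Type*} [Finite τ] {k : ℕ} (hk : 2 ≤ k)
    {step : τ → ℕ → τ} {f : ℕ → τ} (hf : ∀ n d, d < k → f (k * n + d) = step (f n) d)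
    (hbad : ∀ δ : ℝ, 0 < δ →
      ∃ m, 6 ≤ k ^ m ∧ ((badResidues k step m).card : ℝ) ≤ δ * (k : ℝ) ^ m)
    {F : Set (ℕ → ℝ)}
    (hF : ∀ K : ℕ, 0 < K → ∃ C E : ℕ, ∀ ℓ : ℕ, ∃ S : Finset (Fin ℓ → ℕ),
      S.card ≤ C * (ℓ + 1) ^ E ∧ ∀ φ ∈ F, (fun h : Fin ℓ => ⌊φ h⌋₊ % K) ∈ S)
    (hF0 : ∀ φ ∈ F, ∀ h, 0 ≤ φ h) {ε : ℝ} (hε : 0 < ε) :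
    ∃ K : ℕ, 0 < K ∧ ∀ᶠ ℓ : ℕ in atTop, ∃ S : Finset (Fin ℓ → τ),
      (S.card : ℝ) ≤ Real.exp (ε * ℓ) ∧ ∀ φ ∈ F,
        (∀ t : ℕ, 0 < t → t < K →
          ‖∑ h ∈ Finset.range ℓ, expi (t * (φ h / K))‖ ≤ 1 / K * ℓ) →
        (fun h : Fin ℓ => f ⌊φ h⌋₊) ∈ S := by
  classical
  have := Fintype.ofFinite τ
  have : Nonempty τ := ⟨f 0⟩
  have hk0 : 0 < k := by omega
  obtain ⟨δ, hδ, hpow⟩ := exists_pos_pow_floor_le (Fintype.card τ) Fintype.card_pos (half_pos hε)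
  obtain ⟨m, hm, hB⟩ := hbad δ hδ
  have hK : 0 < k ^ m := by positivity
  have hKpos : (0 : ℝ) < ((k ^ m : ℕ) : ℝ) := by exact_mod_cast hK
  refine ⟨k ^ m, hK, ?_⟩
  obtain ⟨C, E, hCE⟩ := hF (k ^ m) hK
  filter_upwards [eventually_mul_pow_le_exp C E (half_pos hε)] with ℓ hℓ
  obtain ⟨patterns, hpc, hpat⟩ := hCE ℓ
  set b := ⌊52 * δ * ℓ⌋₊ with hb
  obtain ⟨S, hSc, hS⟩ := exists_card_words_of_patterns_le patterns
    (fun z => readDigits k step m z (f 0)) (fun z => z ∈ badResidues k step m) b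
  refine ⟨S, ?_, fun φ hφ hsmall => hS _ (hpat φ hφ) ?_ _ ?_⟩
  · calc (S.card : ℝ) ≤ ((C * (ℓ + 1) ^ E * Fintype.card τ ^ b : ℕ) : ℝ) := by
          exact_mod_cast hSc.trans (Nat.mul_le_mul_right _ hpc)
      _ = C * ((ℓ : ℝ) + 1) ^ E * (Fintype.card τ : ℝ) ^ b := by push_cast; rfl
      _ ≤ Real.exp (ε / 2 * ℓ) * Real.exp (ε / 2 * ℓ) :=
          mul_le_mul hℓ (hpow ℓ) (by positivity) (by positivity)
      _ = _ := by rw [← Real.exp_add]; congr 1; ring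
  · have h1 := card_filter_floor_fract_le (ℓ := ℓ) hm (badResidues k step m)
      (x := fun h => φ h / (k ^ m : ℕ)) (fun t ht htK => (hsmall t ht htK).trans_eq (by ring))
    have h4 : (Finset.univ.filter fun h : Fin ℓ => ⌊φ h⌋₊ % k ^ m ∈ badResidues k step m).card =
        ((Finset.range ℓ).filter fun h : ℕ => ⌊((k ^ m : ℕ) : ℝ) *
          Int.fract (φ h / (k ^ m : ℕ))⌋₊ ∈ badResidues k step m).card := by
      simp_rw [fun h => floor_mul_fract_div hK (hF0 φ hφ h)]
      rw [Finset.card_filter, Finset.card_filter, Finset.sum_range]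
    rw [h4, hb]
    refine Nat.le_floor (h1.trans ?_)
    have hBK : ((badResidues k step m).card : ℝ) / (k ^ m : ℕ) ≤ δ := by
      rw [div_le_iff₀ hKpos]
      push_cast
      exact hB
    gcongr
  · intro h hgood
    rw [apply_eq_readDigits hk0 hf m, readDigits_mod]
    exact readDigits_eq_of_not_mem_badResidues hk0 hgood _ _

/-- Windows along which the sequence is close to a rational polynomial contribute few words. -/
theorem exists_card_near_rational_words_le_exp {τ : Type*} [Finite τ] {k : ℕ} (hk : 2 ≤ k)
    {step : τ → ℕ → τ} {f : ℕ → τ} (hf : ∀ n d, d < k → f (k * n + d) = step (f n) d)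
    (hbad : ∀ δ : ℝ, 0 < δ →
      ∃ m, 6 ≤ k ^ m ∧ ((badResidues k step m).card : ℝ) ≤ δ * (k : ℝ) ^ m)
    {F : Set (ℕ → ℝ)}
    (hF : ∀ K : ℕ, 0 < K → ∃ C E : ℕ, ∀ ℓ : ℕ, ∃ S : Finset (Fin ℓ → ℕ),
      S.card ≤ C * (ℓ + 1) ^ E ∧ ∀ φ ∈ F, (fun h : Fin ℓ => ⌊φ h⌋₊ % K) ∈ S)
    (hF2 : ∀ φ ∈ F, ∀ h, 2 ≤ φ h) (d Q : ℕ) {K : ℕ} (hK : 0 < K) {ε : ℝ} (hε : 0 < ε) :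
    ∃ M₀ : ℕ, ∀ M ≥ M₀, ∀ ℓ, ℓ = Q.factorial * M → ∃ S : Finset (Fin ℓ → τ),
      (S.card : ℝ) ≤ Real.exp (ε * ℓ) ∧ ∀ φ ∈ F,
        (∃ q : ℕ, 0 < q ∧ q ≤ Q ∧ ∃ W : ℤ[X], W.natDegree ≤ d + 1 ∧ ∃ b : ℝ, ∀ h < ℓ,
          |q * (φ h / K) - (W.eval (h : ℤ) + b)| < 1 / K) →
        (fun h : Fin ℓ => f ⌊φ h⌋₊) ∈ S := by
  classical
  obtain ⟨C, E, hCE⟩ := hF 3 (by norm_num)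
  obtain ⟨M₁, hM₁⟩ := eventually_atTop.1
    -- There are `q` classes and 3 offsets, each with windows of length `ℓ / q`, so the exponents
    -- add up to `3 * (ε / 6) * ℓ = ε / 2 * ℓ`.
    (eventually_card_polynomial_words_le hk hf hbad d (ε := ε / 6) (by positivity))
  obtain ⟨M₂, hM₂⟩ := eventually_atTop.1
    (eventually_mul_pow_le_exp ((Q : ℝ) * (C * (3 ^ (d + 2)) ^ Q)) E (half_pos hε))
  refine ⟨max M₁ M₂, fun M hM ℓ hℓ => ?_⟩
  have hMℓ : M ≤ ℓ := by
    rw [hℓ]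
    exact Nat.le_mul_of_pos_left _ (Nat.factorial_pos _)
  obtain ⟨P₃, hPc, hP⟩ := hCE ℓ
  have hex : ∀ q : ℕ, ∃ S : Finset (Fin ℓ → τ), 0 < q ∧ q ≤ Q →
      (S.card : ℝ) ≤ C * ((ℓ : ℝ) + 1) ^ E * (3 ^ (d + 2)) ^ Q * Real.exp (ε / 2 * ℓ) ∧
      ∀ φ ∈ F, (∃ W : ℤ[X], W.natDegree ≤ d + 1 ∧ ∃ b : ℝ, ∀ h < ℓ,
          |q * (φ h / K) - (W.eval (h : ℤ) + b)| < 1 / K) →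
        (fun h : Fin ℓ => f ⌊φ h⌋₊) ∈ S := by
    intro q
    by_cases hq : 0 < q ∧ q ≤ Q
    · obtain ⟨e, he⟩ := Nat.dvd_factorial hq.1 hq.2
      have hℓ' : ℓ = q * (e * M) := by rw [hℓ, he, mul_assoc]
      have he0 : 0 < e := Nat.pos_of_ne_zero fun h0 => by
        rw [h0, mul_zero] at he
        exact Nat.factorial_ne_zero _ he
      obtain ⟨I, hIc, hI⟩ := hM₁ (e * M)
        ((le_of_max_le_left hM).trans (Nat.le_mul_of_pos_left _ he0))
      obtain ⟨S, hSc, hS⟩ := exists_card_near_rational_words_le f hq.1 hℓ' hK P₃ I hI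
      refine ⟨S, fun _ => ⟨?_, fun φ hφ => hS φ (hP φ hφ) fun h _ => hF2 φ hφ h⟩⟩
      have h1 : ((I.card : ℝ)) ^ (3 * q) ≤ Real.exp (ε / 2 * ℓ) := by
        refine (pow_le_pow_left₀ (Nat.cast_nonneg _) hIc _).trans (le_of_eq ?_)
        rw [← Real.exp_nat_mul, hℓ']
        congr 1
        push_cast
        ring
      have h2 : ((3 : ℝ) ^ (d + 2)) ^ q ≤ (3 ^ (d + 2)) ^ Q :=
        pow_le_pow_right₀ (one_le_pow₀ (by norm_num)) hq.2
      have h3 : (P₃.card : ℝ) ≤ C * ((ℓ : ℝ) + 1) ^ E := by exact_mod_cast hPc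
      calc (S.card : ℝ) ≤ P₃.card * ((3 : ℝ) ^ (d + 2)) ^ q * (I.card : ℝ) ^ (3 * q) := by
            exact_mod_cast hSc
        _ ≤ _ := by gcongr
    · exact ⟨∅, fun h => absurd h hq⟩
  choose S hS using hex
  refine ⟨(Finset.Icc 1 Q).biUnion S, ?_, fun φ hφ hnear => ?_⟩
  · calc (((Finset.Icc 1 Q).biUnion S).card : ℝ)
        ≤ ∑ q ∈ Finset.Icc 1 Q, ((S q).card : ℝ) := by exact_mod_cast Finset.card_biUnion_le
      _ ≤ ∑ q ∈ Finset.Icc 1 Q,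
            C * ((ℓ : ℝ) + 1) ^ E * (3 ^ (d + 2)) ^ Q * Real.exp (ε / 2 * ℓ) :=
          Finset.sum_le_sum fun q hq => (hS q (Finset.mem_Icc.1 hq)).1
      _ = Q * (C * (3 ^ (d + 2)) ^ Q) * ((ℓ : ℝ) + 1) ^ E * Real.exp (ε / 2 * ℓ) := by
          rw [Finset.sum_const, Nat.card_Icc, Nat.add_sub_cancel, nsmul_eq_mul]
          ring
      _ ≤ Real.exp (ε / 2 * ℓ) * Real.exp (ε / 2 * ℓ) := by
          gcongr
          exact hM₂ ℓ ((le_of_max_le_right hM).trans hMℓ)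
      _ = _ := by rw [← Real.exp_add]; congr 1; ring
  · obtain ⟨q, hq, hqQ, hW⟩ := hnear
    exact Finset.mem_biUnion.2 ⟨q, Finset.mem_Icc.2 ⟨hq, hqQ⟩, (hS q ⟨hq, hqQ⟩).2 φ hφ hW⟩

/-! ### Newton expansion and conclusion -/

theorem powSeq_eq_sum_fwdDiff (c : ℝ) (n h : ℕ) :
    powSeq c n h = ∑ j ∈ Finset.range (h + 1), (h.choose j : ℝ) * Δ_[1] ^[j] (powSeq c n) 0 := by
  have := shift_eq_sum_fwdDiff_iter 1 (powSeq c n) h 0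
  simpa using this

/-- In Newton's expansion the differences of order at least `d` tend to 0, and for fixed `h` only
finitely many terms occur. -/
theorem tendsto_powSeq_sub_newton (c : ℝ) {d K : ℕ} (hd : c < d) (h : ℕ) :
    Tendsto (fun n => powSeq c n h / K -
      ∑ j ∈ Finset.range d, (h.choose j : ℝ) * (Δ_[1] ^[j] (powSeq c n) 0 / K)) atTop (𝓝 0) := by
  have h1 : ∀ j, d ≤ j → Tendsto (fun n => Δ_[1] ^[j] (powSeq c n) 0) atTop (𝓝 0) := by
    intro j hj
    rw [Metric.tendsto_atTop]
    intro ε hε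
    obtain ⟨n₀, hn₀⟩ := tendsto_sup_fwdDiff_iter_powSeq c (d := j)
      (hd.trans_le (by exact_mod_cast hj)) (half_pos hε)
    refine ⟨n₀, fun n hn => ?_⟩
    rw [Real.dist_eq, sub_zero]
    linarith [hn₀ n hn 0]
  have h2 : Tendsto (fun n => ∑ i ∈ Finset.range (h + 1),
      (h.choose (d + i) : ℝ) * (Δ_[1] ^[d + i] (powSeq c n) 0 / K)) atTop (𝓝 0) := by
    have : Tendsto (fun n => ∑ i ∈ Finset.range (h + 1),
        (h.choose (d + i) : ℝ) * (Δ_[1] ^[d + i] (powSeq c n) 0 / K)) atTop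
        (𝓝 (∑ i ∈ Finset.range (h + 1), (h.choose (d + i) : ℝ) * (0 / K))) :=
      tendsto_finsetSum _ fun i _ => ((h1 _ (Nat.le_add_right _ _)).div_const _).const_mul _
    simpa using this
  refine h2.congr fun n => ?_
  have e1 := Finset.sum_range_add
    (fun j => (h.choose j : ℝ) * (Δ_[1] ^[j] (powSeq c n) 0 / K)) d (h + 1)
  have e2 := Finset.sum_range_add
    (fun j => (h.choose j : ℝ) * (Δ_[1] ^[j] (powSeq c n) 0 / K)) (h + 1) d
  have e3 : ∑ i ∈ Finset.range d,
      (h.choose (h + 1 + i) : ℝ) * (Δ_[1] ^[h + 1 + i] (powSeq c n) 0 / K) = 0 := by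
    refine Finset.sum_eq_zero fun i _ => ?_
    rw [Nat.choose_eq_zero_of_lt (by omega)]
    simp
  rw [e3, add_zero, add_comm (h + 1) d, e1] at e2
  rw [powSeq_eq_sum_fwdDiff, Finset.sum_div]
  simp_rw [mul_div_assoc]
  rw [← e2]
  ring

theorem theorem2 {A : Type*} (k : ℕ) (hk : 2 ≤ k) (a : ℕ → A)
    (ha : IsSynchronizingAutomatic k hk a) (c : ℝ) (hc : 1 < c) (hc_int : ∀ m : ℤ, c ≠ m) :
    IsDeterministic fun n : ℕ => a ⌊(n : ℝ) ^ c⌋₊ := by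
  classical
  obtain ⟨τ, hτ, step, f, out, j, v, hf, hout, hj, hv, hsync⟩ := ha.exists_states hk
  simp_rw [hout]
  have hbad := fun (δ : ℝ) (hδ : 0 < δ) => exists_card_badResidues_le hk hj hv hsync hδ
  set d := ⌊c⌋₊ with hd
  have hcd : c < (d + 2 : ℕ) := by
    push_cast
    linarith [Nat.lt_floor_add_one c]
  obtain ⟨n₁, hn₁⟩ := tendsto_sup_fwdDiff_iter_powSeq c hcd one_pos
  set n₂ := max n₁ 2 with hn₂
  set F : Set (ℕ → ℝ) := powSeq c '' Set.Ici n₂ with hFdef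
  have hF2 : ∀ φ ∈ F, ∀ h, 2 ≤ φ h := by
    rintro _ ⟨n, hn, rfl⟩ h
    have h1 : (2 : ℝ) ≤ n := by exact_mod_cast (le_max_right n₁ 2).trans hn
    have h2 : (2 : ℝ) ≤ n + h := by linarith [Nat.cast_nonneg (α := ℝ) h]
    exact h2.trans (Real.self_le_rpow_of_one_le (by linarith) hc.le)
  have hF0 : ∀ φ ∈ F, ∀ h, 0 ≤ φ h := fun φ hφ h => by linarith [hF2 φ hφ h]
  have hF : ∀ K : ℕ, 0 < K → ∃ C E : ℕ, ∀ ℓ : ℕ, ∃ S : Finset (Fin ℓ → ℕ),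
      S.card ≤ C * (ℓ + 1) ^ E ∧ ∀ φ ∈ F, (fun h : Fin ℓ => ⌊φ h⌋₊ % K) ∈ S := by
    intro K hK
    obtain ⟨C, hC⟩ := exists_card_floor_mod_words_le (d + 2) K hK
    refine ⟨C, _, hC F hF0 ?_ ?_⟩
    · rintro _ ⟨n, hn, rfl⟩ x
      exact hn₁ n ((le_max_left n₁ 2).trans hn) x
    · rintro _ ⟨n, hn, rfl⟩ _ ⟨m, hm, rfl⟩
      have h1 : 2 ≤ n := (le_max_right n₁ 2).trans hn
      have h2 : 2 ≤ m := (le_max_right n₁ 2).trans hm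
      exact fwdDiff_iter_powSeq_sub_sign c hcd.le (by omega) (by omega)
  refine isDeterministic_of_card_factorWords_le fun ε hε => ?_
  obtain ⟨K, hK, hsmall⟩ := eventually_card_small_sums_words_le hk hf hbad hF hF0
    (show 0 < ε / 4 by positivity)
  obtain ⟨ℓ₁, hℓ₁⟩ := eventually_atTop.1 hsmall
  have hK' : (0 : ℝ) < K := by exact_mod_cast hK
  obtain ⟨Q, hQ, hdich⟩ := exists_small_sums_or_near_rational d K (show (0 : ℝ) < 1 / K by positivity)
  -- The rates `ε / 4` and `3 * ε / 4` leave room for the union: both counts are at most `exp (3 * ε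
  -- / 4 * ℓ)`, and `2 ≤ exp (ε / 4 * ℓ)` absorbs the factor 2.
  obtain ⟨M₀, hM₀⟩ := exists_card_near_rational_words_le_exp hk hf hbad hF hF2 d Q hK
    (show 0 < 3 * ε / 4 by positivity)
  obtain ⟨H₀, hH₀⟩ := sum_exp_neg_le_one hε
  obtain ⟨ℓ₂, hℓ₂⟩ := eventually_atTop.1 (eventually_le_exp_mul 2 (show 0 < ε / 4 by positivity))
  set M := M₀ + ℓ₁ + ℓ₂ + H₀ + 1 with hM
  -- Divisible by every denominator `q ≤ Q`, so near-rational windows split evenly into classes.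
  set H₁ := Q.factorial * M with hH₁
  have hMH : M ≤ H₁ := Nat.le_mul_of_pos_left _ (Nat.factorial_pos _)
  obtain ⟨H₂, n₃, hn₃⟩ := hdich (fun n h => powSeq c n h / K)
    (fun n j => Δ_[1] ^[j] (powSeq c n) 0 / K) (tendsto_powSeq_sub_newton c hcd)
    H₁ (1 / K) (by positivity)
  have hG₁ : ∀ ℓ : ℕ, ∃ S : Finset (Fin ℓ → τ), H₁ ≤ ℓ → (S.card : ℝ) ≤ Real.exp (ε / 4 * ℓ) ∧
      ∀ φ ∈ F, (∀ t : ℕ, 0 < t → t < K →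
          ‖∑ h ∈ Finset.range ℓ, expi (t * (φ h / K))‖ ≤ 1 / K * ℓ) →
        (fun h : Fin ℓ => f ⌊φ h⌋₊) ∈ S := by
    intro ℓ
    by_cases hℓ : H₁ ≤ ℓ
    · obtain ⟨S, hS⟩ := hℓ₁ ℓ (by omega)
      exact ⟨S, fun _ => hS⟩
    · exact ⟨∅, fun h => absurd h hℓ⟩
  have hG₂ : ∀ ℓ : ℕ, ∃ S : Finset (Fin ℓ → τ), (S.card : ℝ) ≤ Real.exp (3 * ε / 4 * ℓ) ∧
      (ℓ = H₁ → ∀ φ ∈ F,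
        (∃ q : ℕ, 0 < q ∧ q ≤ Q ∧ ∃ W : ℤ[X], W.natDegree ≤ d + 1 ∧ ∃ b : ℝ, ∀ h < ℓ,
          |q * (φ h / K) - (W.eval (h : ℤ) + b)| < 1 / K) →
        (fun h : Fin ℓ => f ⌊φ h⌋₊) ∈ S) := by
    intro ℓ
    by_cases hℓ : ℓ = H₁
    · obtain ⟨S, hSc, hS⟩ := hM₀ M (by omega) ℓ hℓ
      exact ⟨S, hSc, fun _ => hS⟩
    · exact ⟨∅, by simp [Real.exp_nonneg], fun h => absurd h hℓ⟩
  choose G₁ hG₁ using hG₁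
  choose G₂ hG₂c hG₂ using hG₂
  -- Near-rational windows have length `H₁`, which may exceed `H₂`; hence the maximum.
  refine ⟨max n₂ n₃, exists_card_factorWords_le (U := fun n : ℕ => f ⌊(n : ℝ) ^ c⌋₊) hε
    (by omega : 0 < H₁) (hH₀ H₁ (by omega) (max H₁ H₂)) (fun ℓ => G₁ ℓ ∪ G₂ ℓ) ?_ ?_⟩
  · intro ℓ hℓ
    have h1 : (((G₁ ℓ ∪ G₂ ℓ).card : ℕ) : ℝ) ≤ (G₁ ℓ).card + (G₂ ℓ).card := by
      exact_mod_cast Finset.card_union_le _ _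
    have h2 := (hG₁ ℓ hℓ).1
    have h3 := hG₂c ℓ
    have h4 : Real.exp (ε / 4 * ℓ) ≤ Real.exp (3 * ε / 4 * ℓ) := by
      refine Real.exp_le_exp.2 (mul_le_mul_of_nonneg_right (by linarith) (Nat.cast_nonneg _))
    have h5 : Real.exp (ε * ℓ) = Real.exp (ε / 4 * ℓ) * Real.exp (3 * ε / 4 * ℓ) := by
      rw [← Real.exp_add]
      congr 1
      ring
    have h6 := mul_le_mul_of_nonneg_right (hℓ₂ ℓ (by omega)) (Real.exp_nonneg (3 * ε / 4 * ℓ))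
    linarith
  · intro n hn
    have hnF : powSeq c n ∈ F := ⟨n, le_of_max_le_left hn, rfl⟩
    have hword : ∀ ℓ : ℕ, (fun i : Fin ℓ => f ⌊((n + i : ℕ) : ℝ) ^ c⌋₊) =
        fun i : Fin ℓ => f ⌊powSeq c n i⌋₊ := by
      intro ℓ
      funext i
      simp [powSeq]
    rcases hn₃ n (le_of_max_le_right hn) with ⟨ℓ, h1, h2, h3⟩ | h
    · refine ⟨ℓ, h1, le_max_of_le_right h2, ?_⟩
      rw [hword]
      exact Finset.mem_union_left _ ((hG₁ ℓ h1).2 _ hnF h3)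
    · refine ⟨H₁, le_rfl, le_max_left _ _, ?_⟩
      rw [hword]
      exact Finset.mem_union_right _ (hG₂ H₁ rfl _ hnF h)
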